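/- Let $n\in\mathbb N$ and $a,b>0$. For $\lambda\in\mathbb R^*=\mathbb R\setminus\{0\}$ and $x,y\in\mathbb R^n$, $t\in\mathbb R$ let $$\pi_\lambda(x,y,t)\varphi(\xi)=e^{2\pi i\lambda t}e^{2\pi i\lambda(x\cdot\xi+\frac12x\cdot y)}\varphi(\xi+y),\qquad \varphi\in L^2(\mathbb R^n),$$ be the Schrödinger representation of the Heisenberg group. Let $\mathcal B_2$ be the Hilbert space of Hilbert-Schmidt operators on $L^2(\mathbb R^n)$, let $d\kappa(\lambda)=d\lambda/|\lambda|$ be the Haar measure of $\mathbb R^*$, and let $\mathcal G\in L^2(\mathbb R^*,\mathcal B_2;d\kappa)$. Put $(M_{(x,y,t)}F)(\lambda)=\pi_\lambda(x,y,t)F(\lambda)$, $(T_\omega F)(\lambda)=F(\lambda/\omega)$ and, for $(k,l,m)\in\mathbb Z^n\times\mathbb Z^n\times\mathbb Z=\mathbb Z^{2n+1}$, $\mathcal G_{k,l,m}=M_{(2ak,al,am)}\mathcal G$. For $\nu>0$ and $j\in\{1,-1\}$ let $(\nu,j)$ be the character of $\mathbb R^*$ given by $(\nu,1)(\lambda)=e^{2\pi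 i\log\nu\log|\lambda|}$ and $(\nu,-1)(\lambda)=\frac{\lambda}{|\lambda|}e^{2\pi i\log\nu\log|\lambda|}$. Let $F\mapsto\widehat F$ be the Fourier transform on $L^2(\mathbb R^*,\mathcal B_2;d\kappa)$ in its unitary normalization: it is the continuous extension of $\widehat F(\nu,j)=\frac1{\sqrt2}\int_{\mathbb R^*}\overline{(\nu,j)(\lambda)}\,F(\lambda)\,d\kappa(\lambda)$ from $L^1\cap L^2$, so that $\|F\|^2=\sum_{j\in\{1,-1\}}\int_0^\infty\|\widehat F(\nu,j)\|_{\mathcal B_2}^2\frac{d\nu}\nu$. Let $W:L^2(\mathbb C^n)=L^2(\mathbb R^{2n})\to\mathcal B_2$, $W(g)=\int_{\mathbb R^{2n}} g(x,y)\,\pi_1(x,y,0)\,dx\,dy$, be the Weyl transform (an isometric isomorphism onto $\mathcal B_2$), and let $g_{k,l,m}(\cdot,\nu,j)\in L^2(\mathbb C^n)$ be the function with $W(g_{k,l,m}(\cdot,\nu,j))=\widehat{\mathcal G}_{k,l,m}(\nu,j)$. For $\nu\in(1,e^{1/b})$ let $$w_{g_{k,l,m}}(\nu)=\sum_{j\in\{1,-1\}}\sum_{s\in\mathbb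 Z}\|g_{k,l,m}(\cdot,\nu e^{s/b},j)\|_{L^2(\mathbb C^n)}^2\in[0,\infty],\qquad \Omega_{k,l,m}=\{\nu\in(1,e^{1/b}):w_{g_{k,l,m}}(\nu)\neq0\}.$$ Let $S\subseteq\mathbb Z^{2n+1}$ be any set of indices (for $S=\mathbb Z^{2n+1}$ one obtains the full Gabor system $\mathcal U(\mathcal G)=\{T_{e^{bp}}M_{a(2k,l,m)}\mathcal G:k,l\in\mathbb Z^n,\ m,p\in\mathbb Z\}$). Suppose that, for each $j\in\{1,-1\}$ and $s\in\mathbb Z$ and for a.e. $\nu\in(1,e^{1/b})$, the functions $g_{k,l,m}(\cdot,\nu e^{s/b},j)$, $(k,l,m)\in S$, are pairwise orthogonal in $L^2(\mathbb C^n)$. Then the family $\{T_{e^{bp}}\mathcal G_{k,l,m}:(k,l,m)\in S,\ p\in\mathbb Z\}$ is a Parseval frame sequence, that is, every $F$ in its closed linear span satisfies $\sum_{(k,l,m)\in S,\,p\in\mathbb Z}|\langle F,T_{e^{bp}}\mathcal G_{k,l,m}\rangle|^2=\|F\|^2$, if and only if for every $(k,l,m)\in S$ one has $w_{g_{k,l,m}}(\nu)=b$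 for a.e. $\nu\in\Omega_{k,l,m}$. -/

import Mathlib

open MeasureTheory
open scoped FourierTransform ComplexInnerProductSpace ENNReal

namespace HeisenbergGabor
noncomputable section

section HilbertSchmidt

/-! ### Hilbert-Schmidt operators on a complex Hilbert space -/

variable (H : Type) [NormedAddCommGroup H] [InnerProductSpace ℂ H] [CompleteSpace H]

/-- The index set of a fixed orthonormal (Hilbert) basis of `H`. -/
def basisIndex : Set H := Classical.choose (exists_hilbertBasis ℂ H)

/-- A fixed orthonormal (Hilbert) basis of `H`. Nothing below depends on the choice, see
`HilbertSchmidt.enorm_sq_eq_tsum` and `HilbertSchmidt.exists_toCLM_eq_iff`. -/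
def basis : HilbertBasis (basisIndex H) ℂ H :=
  Classical.choose (Classical.choose_spec (exists_hilbertBasis ℂ H))

/-- The bounded operators `T` with `∑ᵢ ‖T eᵢ‖² < ∞`. -/
def hilbertSchmidtSubmodule : Submodule ℂ (H →L[ℂ] H) where
  carrier := {T | Memℓp (fun i => T (basis H i)) 2}
  zero_mem' := zero_memℓp
  add_mem' hS hT := hS.add hT
  smul_mem' c _ hT := hT.const_smul c

/-- The Hilbert space `𝓑₂(H)` of Hilbert-Schmidt operators on `H`. It is not reducible to the
submodule of `H →L[ℂ] H`, since it carries the Hilbert-Schmidt norm, not the operator norm. -/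
def HilbertSchmidt : Type := hilbertSchmidtSubmodule H

namespace HilbertSchmidt

instance : AddCommGroup (HilbertSchmidt H) := inferInstanceAs (AddCommGroup (hilbertSchmidtSubmodule H))
instance : Module ℂ (HilbertSchmidt H) := inferInstanceAs (Module ℂ (hilbertSchmidtSubmodule H))

variable {H}

/-- The underlying bounded operator. -/
def toCLM (T : HilbertSchmidt H) : H →L[ℂ] H := T.1

theorem memlp_toCLM (T : HilbertSchmidt H) : Memℓp (fun i => T.toCLM (basis H i)) 2 := T.2

/-- A bounded operator with `∑ᵢ ‖A eᵢ‖² < ∞`, as a Hilbert-Schmidt operator. -/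
def ofCLM (A : H →L[ℂ] H) (hA : Memℓp (fun i => A (basis H i)) 2) : HilbertSchmidt H := ⟨A, hA⟩

theorem toCLM_ofCLM (A : H →L[ℂ] H) (hA : Memℓp (fun i => A (basis H i)) 2) :
    (ofCLM A hA).toCLM = A := rfl

variable (H) in
/-- `T ↦ (T eᵢ)ᵢ`, which induces the Hilbert-Schmidt norm and inner product. -/
def toSeq : HilbertSchmidt H →ₗ[ℂ] lp (fun _ : basisIndex H => H) 2 where
  toFun T := ⟨fun i => T.toCLM (basis H i), T.2⟩
  map_add' _ _ := rfl
  map_smul' _ _ := rfl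

theorem toSeq_apply (T : HilbertSchmidt H) (i : basisIndex H) :
    toSeq H T i = T.toCLM (basis H i) := rfl

theorem toCLM_le (T : HilbertSchmidt H) : ‖T.toCLM‖ ≤ ‖toSeq H T‖ := by
  refine ContinuousLinearMap.opNorm_le_bound _ (norm_nonneg _) fun x => ?_
  have h1 : HasSum (fun i => (basis H).repr x i • toSeq H T i) (T.toCLM x) := by
    simpa [toSeq_apply] using T.toCLM.hasSum ((basis H).hasSum_repr x)
  have hx := lp.hasSum_norm (p := 2) (by norm_num) ((basis H).repr x)
  have hT := lp.hasSum_norm (p := 2) (by norm_num) (toSeq H T)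
  simp only [ENNReal.toReal_ofNat] at hx hT
  have h2 := Real.inner_le_Lp_mul_Lq_tsum_of_nonneg (p := 2) (q := 2) (by
    constructor <;> norm_num) (fun i => norm_nonneg ((basis H).repr x i))
    (fun i => norm_nonneg (toSeq H T i)) hx.summable hT.summable
  have h3 := Real.summable_mul_of_Lp_Lq_of_nonneg (p := 2) (q := 2) (by
    constructor <;> norm_num) (fun i => norm_nonneg ((basis H).repr x i))
    (fun i => norm_nonneg (toSeq H T i)) hx.summable hT.summable
  rw [hx.tsum_eq, hT.tsum_eq] at h2
  have e : ∀ r : ℝ, 0 ≤ r → (r ^ (2:ℝ)) ^ (1 / (2:ℝ)) = r := fun r hr => by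
    rw [← Real.rpow_mul hr]; norm_num
  rw [e _ (norm_nonneg _), e _ (norm_nonneg _), LinearIsometryEquiv.norm_map] at h2
  rw [← h1.tsum_eq, mul_comm]
  refine le_trans (norm_tsum_le_tsum_norm ?_) ?_
  · simpa [norm_smul] using h3
  · simpa [norm_smul] using h2

theorem toCLM_injective : Function.Injective (toCLM : HilbertSchmidt H → H →L[ℂ] H) :=
  Subtype.val_injective

theorem toSeq_injective : Function.Injective (toSeq H) := by
  rw [← LinearMap.ker_eq_bot, LinearMap.ker_eq_bot']
  intro T hT
  have := toCLM_le T
  rw [hT, norm_zero] at this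
  exact toCLM_injective (norm_le_zero_iff.1 this)

instance : NormedAddCommGroup (HilbertSchmidt H) :=
  NormedAddCommGroup.induced _ _ (toSeq H) toSeq_injective

/-- The inner product `⟪S, T⟫ = ∑ᵢ ⟪S eᵢ, T eᵢ⟫ = tr (T S*)` (linear in the second slot). -/
instance : InnerProductSpace ℂ (HilbertSchmidt H) where
  inner S T := inner ℂ (toSeq H S) (toSeq H T)
  norm_smul_le c T := by
    change ‖toSeq H (c • T)‖ ≤ ‖c‖ * ‖toSeq H T‖
    rw [map_smul, norm_smul]
  norm_sq_eq_re_inner T := norm_sq_eq_re_inner (𝕜 := ℂ) (toSeq H T)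
  conj_inner_symm S T := inner_conj_symm (𝕜 := ℂ) (toSeq H S) (toSeq H T)
  add_left R S T := by rw [map_add, inner_add_left]
  smul_left S T c := by rw [map_smul, inner_smul_left]

theorem inner_eq_tsum (S T : HilbertSchmidt H) :
    inner ℂ S T = ∑' i, inner ℂ (S.toCLM (basis H i)) (T.toCLM (basis H i)) := rfl

theorem norm_eq (T : HilbertSchmidt H) : ‖T‖ = ‖toSeq H T‖ := rfl

theorem norm_sq_eq (T : HilbertSchmidt H) :
    HasSum (fun i => ‖T.toCLM (basis H i)‖ ^ 2) (‖T‖ ^ 2) := by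
  have hT := lp.hasSum_norm (p := 2) (by norm_num) (toSeq H T)
  simpa [toSeq_apply, norm_eq] using hT

instance : CompleteSpace (HilbertSchmidt H) := by
  refine Metric.complete_of_cauchySeq_tendsto fun u hu => ?_
  have hs : CauchySeq fun k => toSeq H (u k) := by
    rw [Metric.cauchySeq_iff] at hu ⊢
    intro ε hε
    obtain ⟨N, hN⟩ := hu ε hε
    refine ⟨N, fun m hm k hk => ?_⟩
    rw [dist_eq_norm, ← map_sub, ← norm_eq, ← dist_eq_norm]
    exact hN m hm k hk
  have ho : CauchySeq fun k => (u k).toCLM := by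
    rw [Metric.cauchySeq_iff] at hu ⊢
    intro ε hε
    obtain ⟨N, hN⟩ := hu ε hε
    refine ⟨N, fun m hm k hk => lt_of_le_of_lt ?_ (hN m hm k hk)⟩
    rw [dist_eq_norm, dist_eq_norm]
    exact toCLM_le (u m - u k)
  obtain ⟨A, hA⟩ := cauchySeq_tendsto_of_complete ho
  obtain ⟨c, hc⟩ := cauchySeq_tendsto_of_complete hs
  have hAc : (fun i => A (basis H i)) = c := by
    funext i
    have h1 : Filter.Tendsto (fun k => (u k).toCLM (basis H i)) Filter.atTop (nhds (A (basis H i))) :=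
      ((ContinuousLinearMap.apply ℂ H (basis H i)).continuous.tendsto A).comp hA
    have h2 : Filter.Tendsto (fun k => toSeq H (u k) i) Filter.atTop (nhds (c i)) := by
      rw [tendsto_iff_norm_sub_tendsto_zero] at hc ⊢
      refine squeeze_zero (fun _ => norm_nonneg _) (fun k => ?_) hc
      exact lp.norm_apply_le_norm (by norm_num) (toSeq H (u k) - c) i
    exact tendsto_nhds_unique h1 h2
  refine ⟨ofCLM A (by rw [hAc]; exact lp.memℓp c), ?_⟩
  have hseq : toSeq H (ofCLM A (by rw [hAc]; exact lp.memℓp c)) = c := by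
    ext i
    rw [toSeq_apply, toCLM_ofCLM]
    exact congrFun hAc i
  rw [tendsto_iff_norm_sub_tendsto_zero] at hc ⊢
  refine hc.congr fun k => ?_
  rw [norm_eq, map_sub, hseq]

/-- The composition `A T` of a bounded operator with a Hilbert-Schmidt operator. -/
def lmul (A : H →L[ℂ] H) (T : HilbertSchmidt H) : HilbertSchmidt H :=
  ofCLM (A ∘L T.toCLM) (by
    have h : Memℓp (fun i => (‖A‖ : ℂ) • T.toCLM (basis H i)) 2 :=
      T.memlp_toCLM.const_smul (‖A‖ : ℂ)
    refine memℓp_gen ?_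
    refine Summable.of_nonneg_of_le (fun i => by positivity) (fun i => ?_)
      (h.summable (by norm_num))
    rw [norm_smul, Complex.norm_real, norm_norm]
    exact Real.rpow_le_rpow (norm_nonneg _) (A.le_opNorm _) (by norm_num))

theorem toCLM_lmul (A : H →L[ℂ] H) (T : HilbertSchmidt H) : (lmul A T).toCLM = A ∘L T.toCLM := rfl

theorem lmul_sub (A : H →L[ℂ] H) (S T : HilbertSchmidt H) : lmul A (S - T) = lmul A S - lmul A T := by
  apply toCLM_injective
  change A ∘L (S.toCLM - T.toCLM) = A ∘L S.toCLM - A ∘L T.toCLM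
  simp

theorem norm_lmul_le (A : H →L[ℂ] H) (hA : ∀ v, ‖A v‖ ≤ ‖v‖) (T : HilbertSchmidt H) :
    ‖lmul A T‖ ≤ ‖T‖ := by
  refine (sq_le_sq₀ (norm_nonneg _) (norm_nonneg _)).1 ?_
  rw [← (norm_sq_eq _).tsum_eq, ← (norm_sq_eq T).tsum_eq]
  refine (norm_sq_eq (lmul A T)).summable.tsum_le_tsum (fun i => ?_) (norm_sq_eq T).summable
  exact pow_le_pow_left₀ (norm_nonneg _) (hA _) 2

/-- Strongly continuous families of contractions act jointly continuously. -/
theorem continuous_lmul {X : Type} [TopologicalSpace X] (A : X → H →L[ℂ] H)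
    (hA : ∀ x v, ‖A x v‖ ≤ ‖v‖) (hc : ∀ v, Continuous fun x => A x v) :
    Continuous fun q : X × HilbertSchmidt H => lmul (A q.1) q.2 := by
  rw [continuous_iff_continuousAt]
  rintro ⟨x₀, T₀⟩
  have key : Filter.Tendsto (fun x => ‖lmul (A x) T₀ - lmul (A x₀) T₀‖) (nhds x₀) (nhds 0) := by
    have h2 : Filter.Tendsto (fun x => ‖lmul (A x) T₀ - lmul (A x₀) T₀‖ ^ 2) (nhds x₀) (nhds 0) := by
      have h3 : ∀ x, ‖lmul (A x) T₀ - lmul (A x₀) T₀‖ ^ 2 =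
          ∑' i, ‖A x (T₀.toCLM (basis H i)) - A x₀ (T₀.toCLM (basis H i))‖ ^ 2 := fun x =>
        (norm_sq_eq _).tsum_eq.symm
      simp_rw [h3]
      have h4 : (0 : ℝ) = ∑' _ : basisIndex H, (0 : ℝ) := tsum_zero.symm
      rw [h4]
      refine tendsto_tsum_of_dominated_convergence
        (bound := fun i => 4 * ‖T₀.toCLM (basis H i)‖ ^ 2) ?_ ?_ ?_
      · exact (norm_sq_eq T₀).summable.mul_left 4
      · intro i
        have := ((hc (T₀.toCLM (basis H i))).tendsto x₀)
        rw [tendsto_iff_norm_sub_tendsto_zero] at this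
        simpa using this.pow 2
      · refine Filter.Eventually.of_forall fun x i => ?_
        rw [Real.norm_of_nonneg (by positivity)]
        have h5 : ‖A x (T₀.toCLM (basis H i)) - A x₀ (T₀.toCLM (basis H i))‖
            ≤ 2 * ‖T₀.toCLM (basis H i)‖ := by
          refine (norm_sub_le _ _).trans ?_
          linarith [hA x (T₀.toCLM (basis H i)), hA x₀ (T₀.toCLM (basis H i))]
        calc _ ≤ (2 * ‖T₀.toCLM (basis H i)‖) ^ 2 := pow_le_pow_left₀ (norm_nonneg _) h5 2
          _ = _ := by ring
    have := h2.sqrt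
    simpa [Real.sqrt_sq] using this
  rw [ContinuousAt, tendsto_iff_norm_sub_tendsto_zero]
  have h6 : Filter.Tendsto (fun q : X × HilbertSchmidt H => ‖q.2 - T₀‖ +
      ‖lmul (A q.1) T₀ - lmul (A x₀) T₀‖) (nhds (x₀, T₀)) (nhds 0) := by
    have h7 : Filter.Tendsto (fun q : X × HilbertSchmidt H => ‖q.2 - T₀‖) (nhds (x₀, T₀))
        (nhds 0) := by
      have : Continuous fun q : X × HilbertSchmidt H => ‖q.2 - T₀‖ := by fun_prop
      simpa using this.tendsto (x₀, T₀)
    have h8 := key.comp (continuous_fst.tendsto (x₀, T₀))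
    simpa using h7.add h8
  refine squeeze_zero (fun _ => norm_nonneg _) (fun q => ?_) h6
  calc ‖lmul (A q.1) q.2 - lmul (A x₀) T₀‖
      = ‖lmul (A q.1) (q.2 - T₀) + (lmul (A q.1) T₀ - lmul (A x₀) T₀)‖ := by
        rw [lmul_sub]; congr 1; abel
    _ ≤ _ := (norm_add_le _ _).trans (by gcongr; exact norm_lmul_le _ (hA _) _)


theorem aestronglyMeasurable_lmul {A : ℝ → H →L[ℂ] H}
    (hA : ∀ x v, ‖A x v‖ ≤ ‖v‖) (hc : ∀ v, Continuous fun x => A x v) {μ : Measure ℝ}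
    {F : ℝ → HilbertSchmidt H} (hF : AEStronglyMeasurable F μ) :
    AEStronglyMeasurable (fun x => lmul (A x) (F x)) μ :=
  (continuous_lmul A hA hc).comp_aestronglyMeasurable (aestronglyMeasurable_id.prodMk hF)

theorem tsum_enorm_sq_adjoint {ι κ : Type} (c : HilbertBasis ι ℂ H) (d : HilbertBasis κ ℂ H)
    (A : H →L[ℂ] H) :
    ∑' i, ‖A (c i)‖ₑ ^ 2 = ∑' k, ‖ContinuousLinearMap.adjoint A (d k)‖ₑ ^ 2 := by
  have parseval : ∀ {ι' : Type} (e : HilbertBasis ι' ℂ H) (v : H),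
      ‖v‖ₑ ^ 2 = ∑' i, ‖inner ℂ (e i) v‖ₑ ^ 2 := by
    intro ι' e v
    have h := lp.hasSum_norm (p := 2) (by norm_num) (e.repr v)
    simp only [ENNReal.toReal_ofNat, Real.rpow_ofNat, LinearIsometryEquiv.norm_map,
      e.repr_apply_apply] at h
    simp_rw [← ofReal_norm, ← ENNReal.ofReal_pow (norm_nonneg _)]
    rw [← ENNReal.ofReal_tsum_of_nonneg (fun _ => by positivity) h.summable, h.tsum_eq]
  calc ∑' i, ‖A (c i)‖ₑ ^ 2 = ∑' i, ∑' k, ‖inner ℂ (d k) (A (c i))‖ₑ ^ 2 := by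
        simp_rw [← parseval d]
    _ = ∑' k, ∑' i, ‖inner ℂ (d k) (A (c i))‖ₑ ^ 2 := ENNReal.tsum_comm
    _ = ∑' k, ∑' i, ‖inner ℂ (c i) (ContinuousLinearMap.adjoint A (d k))‖ₑ ^ 2 := by
        refine tsum_congr fun k => tsum_congr fun i => ?_
        rw [ContinuousLinearMap.adjoint_inner_right, ← inner_conj_symm, ← ofReal_norm, ← ofReal_norm,
          RCLike.norm_conj]
    _ = _ := by simp_rw [← parseval c]

/-- The Hilbert-Schmidt norm may be computed in any orthonormal basis. -/
theorem enorm_sq_eq_tsum {ι : Type} (c : HilbertBasis ι ℂ H) (T : HilbertSchmidt H) :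
    ‖T‖ₑ ^ 2 = ∑' i, ‖T.toCLM (c i)‖ₑ ^ 2 := by
  rw [tsum_enorm_sq_adjoint c (basis H), ← tsum_enorm_sq_adjoint (basis H) (basis H)]
  have h := norm_sq_eq T
  simp_rw [← ofReal_norm, ← ENNReal.ofReal_pow (norm_nonneg _)]
  rw [← ENNReal.ofReal_tsum_of_nonneg (fun _ => by positivity) h.summable, h.tsum_eq]

/-- Being Hilbert-Schmidt may be tested in any orthonormal basis. -/
theorem exists_toCLM_eq_iff {ι : Type} (c : HilbertBasis ι ℂ H) (A : H →L[ℂ] H) :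
    (∃ T : HilbertSchmidt H, T.toCLM = A) ↔ ∑' i, ‖A (c i)‖ₑ ^ 2 ≠ ⊤ := by
  constructor
  · rintro ⟨T, rfl⟩
    rw [← enorm_sq_eq_tsum]
    exact ENNReal.pow_ne_top enorm_ne_top
  · intro h
    rw [tsum_enorm_sq_adjoint c (basis H), ← tsum_enorm_sq_adjoint (basis H) (basis H)] at h
    refine ⟨ofCLM A (memℓp_gen ?_), rfl⟩
    have := ENNReal.summable_toReal h
    simpa [toReal_enorm] using this

end HilbertSchmidt
end HilbertSchmidt

/-! ### The Schrödinger representations of the Heisenberg group -/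

/-- `ℝⁿ`. -/
abbrev Vec (n : ℕ) : Type := EuclideanSpace ℝ (Fin n)

/-- `L²(ℝⁿ)`. -/
abbrev L2Rn (n : ℕ) : Type := Lp ℂ 2 (volume : Measure (Vec n))

theorem memLp_mulUnimodular {n : ℕ} (c : Vec n → ℂ) (hc : Continuous c) (h1 : ∀ ξ, ‖c ξ‖ = 1)
    (φ : L2Rn n) : MemLp (fun ξ => c ξ * φ ξ) 2 volume :=
  (Lp.memLp φ).of_le (hc.aestronglyMeasurable.mul (Lp.aestronglyMeasurable φ))
    (Filter.Eventually.of_forall fun ξ => by simp [h1])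

/-- Multiplication by a continuous unimodular function. -/
def mulUnimodular {n : ℕ} (c : Vec n → ℂ) (hc : Continuous c) (h1 : ∀ ξ, ‖c ξ‖ = 1) :
    L2Rn n →ₗᵢ[ℂ] L2Rn n where
  toFun φ := (memLp_mulUnimodular c hc h1 φ).toLp
  map_add' φ ψ := by
    rw [← MemLp.toLp_add]
    refine MemLp.toLp_congr _ _ ?_
    filter_upwards [Lp.coeFn_add φ ψ] with ξ h
    rw [h, Pi.add_apply, Pi.add_apply, mul_add]
  map_smul' r φ := by
    rw [RingHom.id_apply, ← MemLp.toLp_const_smul]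
    refine MemLp.toLp_congr _ _ ?_
    filter_upwards [Lp.coeFn_smul r φ] with ξ h
    simp only [h, Pi.smul_apply, smul_eq_mul]
    ring
  norm_map' φ := by
    change ‖(memLp_mulUnimodular c hc h1 φ).toLp‖ = ‖φ‖
    rw [Lp.norm_toLp, Lp.norm_def]
    congr 1
    exact eLpNorm_congr_norm_ae (Filter.Eventually.of_forall fun ξ => by simp [h1])

theorem coeFn_mulUnimodular {n : ℕ} (c : Vec n → ℂ) (hc : Continuous c) (h1 : ∀ ξ, ‖c ξ‖ = 1)
    (φ : L2Rn n) : mulUnimodular c hc h1 φ =ᵐ[volume] fun ξ => c ξ * φ ξ :=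
  MemLp.coeFn_toLp (memLp_mulUnimodular c hc h1 φ)

/-- The factor `e^{2πiλt} e^{2πiλ(x·ξ + x·y/2)}`. -/
def schrodingerPhase {n : ℕ} (lam : ℝ) (x y : Vec n) (t : ℝ) (ξ : Vec n) : ℂ :=
  Complex.exp ((2 * Real.pi * lam * t : ℝ) * Complex.I) *
    Complex.exp ((2 * Real.pi * lam * (inner ℝ x ξ + 1 / 2 * inner ℝ x y) : ℝ) * Complex.I)

theorem norm_schrodingerPhase {n : ℕ} (lam : ℝ) (x y : Vec n) (t : ℝ) (ξ : Vec n) :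
    ‖schrodingerPhase lam x y t ξ‖ = 1 := by
  rw [schrodingerPhase, norm_mul, Complex.norm_exp_ofReal_mul_I, Complex.norm_exp_ofReal_mul_I,
    mul_one]

theorem continuous_schrodingerPhase {n : ℕ} (lam : ℝ) (x y : Vec n) (t : ℝ) :
    Continuous (schrodingerPhase lam x y t) := by
  unfold schrodingerPhase
  fun_prop

/-- The Schrödinger representation
`π_λ(x,y,t) φ (ξ) = e^{2πiλt} e^{2πiλ(x·ξ + x·y/2)} φ(ξ + y)` on `L²(ℝⁿ)`; the formula is
`coeFn_schrodinger`. -/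
def schrodinger {n : ℕ} (lam : ℝ) (x y : Vec n) (t : ℝ) : L2Rn n →L[ℂ] L2Rn n :=
  ((mulUnimodular (schrodingerPhase lam x y t) (continuous_schrodingerPhase lam x y t)
      (norm_schrodingerPhase lam x y t)).comp
    (Lp.compMeasurePreservingₗᵢ ℂ (fun ξ : Vec n => ξ + y)
      (measurePreserving_add_right volume y))).toContinuousLinearMap

theorem coeFn_schrodinger {n : ℕ} (lam : ℝ) (x y : Vec n) (t : ℝ) (φ : L2Rn n) :
    schrodinger lam x y t φ =ᵐ[volume] fun ξ =>
      Complex.exp ((2 * Real.pi * lam * t : ℝ) * Complex.I) *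
        Complex.exp ((2 * Real.pi * lam * (inner ℝ x ξ + 1 / 2 * inner ℝ x y) : ℝ) * Complex.I) *
        φ (ξ + y) := by
  refine (coeFn_mulUnimodular _ (continuous_schrodingerPhase lam x y t)
    (norm_schrodingerPhase lam x y t) _).trans ?_
  filter_upwards [Lp.coeFn_compMeasurePreserving φ (measurePreserving_add_right volume y)] with ξ h
  change _ * (Lp.compMeasurePreserving _ _ φ) ξ = _
  rw [h]
  rfl

theorem norm_schrodinger {n : ℕ} (lam : ℝ) (x y : Vec n) (t : ℝ) (φ : L2Rn n) :
    ‖schrodinger lam x y t φ‖ = ‖φ‖ := LinearIsometry.norm_map _ φ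

theorem continuous_schrodinger {n : ℕ} (x y : Vec n) (t : ℝ) (φ : L2Rn n) :
    Continuous fun lam : ℝ => schrodinger lam x y t φ := by
  set ψ : L2Rn n := Lp.compMeasurePreserving (fun ξ : Vec n => ξ + y)
      (measurePreserving_add_right volume y) φ with hψ
  have hcoe : ∀ lam, (schrodinger lam x y t φ : Vec n → ℂ) =ᵐ[volume]
      fun ξ => schrodingerPhase lam x y t ξ * ψ ξ := fun lam =>
    coeFn_mulUnimodular _ (continuous_schrodingerPhase lam x y t)
      (norm_schrodingerPhase lam x y t) ψ
  rw [continuous_iff_continuousAt]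
  intro l₀
  rw [ContinuousAt, Lp.tendsto_Lp_iff_tendsto_eLpNorm']
  have h2 : Filter.Tendsto (fun l => ∫⁻ ξ, ‖(schrodingerPhase l x y t ξ -
      schrodingerPhase l₀ x y t ξ) * ψ ξ‖ₑ ^ (2 : ℝ)) (nhds l₀) (nhds (∫⁻ _ : Vec n, 0)) := by
    refine tendsto_lintegral_filter_of_dominated_convergence
      (fun ξ => (2 * ‖ψ ξ‖ₑ) ^ (2 : ℝ)) ?_ ?_ ?_ ?_
    · refine Filter.Eventually.of_forall fun l => ?_
      have := (continuous_schrodingerPhase l x y t).measurable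
      have := (continuous_schrodingerPhase l₀ x y t).measurable
      have := (Lp.stronglyMeasurable ψ).measurable
      fun_prop
    · refine Filter.Eventually.of_forall fun l => Filter.Eventually.of_forall fun ξ => ?_
      refine ENNReal.rpow_le_rpow ?_ (by norm_num)
      rw [enorm_mul]
      gcongr
      refine enorm_sub_le.trans ?_
      rw [← ofReal_norm, ← ofReal_norm, norm_schrodingerPhase, norm_schrodingerPhase]
      norm_num
    · have h := lintegral_rpow_enorm_lt_top_of_eLpNorm_lt_top (p := 2) (by norm_num) (by norm_num)
        (Lp.eLpNorm_lt_top ψ)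
      simp_rw [ENNReal.mul_rpow_of_nonneg _ _ (show (0:ℝ) ≤ 2 by norm_num)]
      rw [lintegral_const_mul' _ _ (by norm_num)]
      exact ENNReal.mul_ne_top (by norm_num) (by simpa using h.ne)
    · refine Filter.Eventually.of_forall fun ξ => ?_
      have hc : Continuous fun l => ‖(schrodingerPhase l x y t ξ -
          schrodingerPhase l₀ x y t ξ) * ψ ξ‖ₑ ^ (2 : ℝ) := by
        unfold schrodingerPhase
        fun_prop
      simpa using hc.tendsto l₀
  have h3 : ∀ l, eLpNorm (⇑(schrodinger l x y t φ) - ⇑(schrodinger l₀ x y t φ)) 2 volume =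
      (∫⁻ ξ, ‖(schrodingerPhase l x y t ξ -
      schrodingerPhase l₀ x y t ξ) * ψ ξ‖ₑ ^ (2 : ℝ)) ^ (1 / (2:ℝ)) := by
    intro l
    rw [eLpNorm_eq_lintegral_rpow_enorm_toReal (by norm_num) (by norm_num)]
    simp only [ENNReal.toReal_ofNat]
    congr 1
    refine lintegral_congr_ae ?_
    filter_upwards [hcoe l, hcoe l₀] with ξ h h'
    rw [Pi.sub_apply, h, h', sub_mul]
  simp_rw [h3]
  have := h2.ennrpow_const (1 / (2:ℝ))
  simpa using this

/-! ### The space `L²(ℝ*, 𝓑₂; dκ)`, modulation and translation -/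

/-- The Haar measure `dκ(λ) = dλ/|λ|` of `ℝ*`, as a measure on `ℝ` for which `{0}` is null. -/
def kappa : Measure ℝ := volume.withDensity fun lam => ENNReal.ofReal |lam|⁻¹

/-- `𝓑₂ = 𝓑₂(L²(ℝⁿ))`. -/
abbrev B2 (n : ℕ) : Type := HilbertSchmidt (L2Rn n)

/-- `L²(ℝ*, 𝓑₂; dκ)`. -/
abbrev L2B2 (n : ℕ) : Type := Lp (B2 n) 2 kappa

theorem memLp_modulation {n : ℕ} (x y : Vec n) (t : ℝ) (F : L2B2 n) :
    MemLp (fun lam => HilbertSchmidt.lmul (schrodinger lam x y t) (F lam)) 2 kappa := by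
  refine (Lp.memLp F).of_le ?_ (Filter.Eventually.of_forall fun lam => ?_)
  · exact HilbertSchmidt.aestronglyMeasurable_lmul
      (fun lam v => (norm_schrodinger lam x y t v).le) (continuous_schrodinger x y t)
      (Lp.aestronglyMeasurable F)
  · exact HilbertSchmidt.norm_lmul_le _ (fun v => (norm_schrodinger lam x y t v).le) _

/-- `(M_{(x,y,t)} F)(λ) = π_λ(x,y,t) F(λ)`. -/
def modulation {n : ℕ} (x y : Vec n) (t : ℝ) (F : L2B2 n) : L2B2 n :=
  (memLp_modulation x y t F).toLp (fun lam => HilbertSchmidt.lmul (schrodinger lam x y t) (F lam))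

theorem measurePreserving_div (om : ℝ) (hom : om ≠ 0) :
    MeasurePreserving (fun lam : ℝ => lam / om) kappa kappa := by
  have hm : Measurable fun lam : ℝ => lam / om := by fun_prop
  refine ⟨hm, ?_⟩
  ext s hs
  rw [Measure.map_apply hm hs, kappa, withDensity_apply _ hs, withDensity_apply _ (hm hs)]
  have himg : (fun lam : ℝ => lam * om) '' s = (fun lam : ℝ => lam / om) ⁻¹' s := by
    ext u
    constructor
    · rintro ⟨v, hv, rfl⟩
      simpa [hom] using hv
    · intro hu
      exact ⟨u / om, hu, by simp [hom]⟩
  rw [← himg, lintegral_image_eq_lintegral_abs_deriv_mul hs (f' := fun _ => om)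
    (fun u _ => by simpa using (hasDerivAt_mul_const (x := u) om).hasDerivWithinAt)
    (fun u _ v _ h => mul_right_cancel₀ hom h)]
  refine lintegral_congr fun u => ?_
  rw [← ENNReal.ofReal_mul (abs_nonneg _), abs_mul, mul_inv]
  congr 1
  have : |om| ≠ 0 := abs_ne_zero.2 hom
  field_simp

/-- `(T_ω F)(λ) = F(λ/ω)`. -/
def translation {n : ℕ} (om : ℝ) (hom : om ≠ 0) (F : L2B2 n) : L2B2 n :=
  Lp.compMeasurePreserving (fun lam : ℝ => lam / om) (measurePreserving_div om hom) F

/-! ### The Fourier transform on `L²(ℝ*, 𝓑₂; dκ)` -/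

/-- The characters `ς_1 = 1` and `ς_{-1}(±1) = ±1` of `{1,-1}`. -/
def signChar (j e : ℤˣ) : ℂ := if j = 1 then 1 else ((e : ℤ) : ℂ)

/-- `λ/|λ|` for `λ ≠ 0`. -/
def realSign (lam : ℝ) : ℤˣ := if 0 < lam then 1 else -1

/-- The character `(ν,j)(λ) = e^{2πi log ν log |λ|} ς_j(λ/|λ|)` of `ℝ*`. -/
def dualChar (nu : ℝ) (j : ℤˣ) (lam : ℝ) : ℂ :=
  Complex.exp ((2 * Real.pi * Real.log nu * Real.log |lam| : ℝ) * Complex.I) *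
    signChar j (realSign lam)

/-- Logarithmic coordinates `u ↦ ε e^u` on the half line of sign `ε`. They carry `du` to `dκ`. -/
def halfLine (e : ℤˣ) (u : ℝ) : ℝ := ((e : ℤ) : ℝ) * Real.exp u

theorem map_halfLine_apply (e : ℤˣ) (s : Set ℝ) (hs : MeasurableSet s) :
    Measure.map (halfLine e) volume s = kappa (s ∩ Set.range (halfLine e)) := by
  have he : ((e : ℤ) : ℝ) ≠ 0 := by
    rcases Int.units_eq_one_or e with rfl | rfl <;> simp
  have hm : Measurable (halfLine e) := by unfold halfLine; fun_prop
  have hinj : Function.Injective (halfLine e) := fun u v h =>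
    Real.exp_injective (mul_left_cancel₀ he h)
  have himg : halfLine e '' (halfLine e ⁻¹' s) = s ∩ Set.range (halfLine e) :=
    Set.image_preimage_eq_inter_range
  have hmi : MeasurableSet (s ∩ Set.range (halfLine e)) := by
    rw [← himg]
    exact (hm hs).image_of_measurable_injOn hm hinj.injOn
  rw [Measure.map_apply hm hs, kappa, withDensity_apply _ hmi, ← himg,
    lintegral_image_eq_lintegral_abs_deriv_mul (f := halfLine e) (hm hs) (f' := halfLine e)
    (fun u _ => ((Real.hasDerivAt_exp u).const_mul ((e : ℤ) : ℝ)).hasDerivWithinAt) hinj.injOn]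
  have : ∀ u, ENNReal.ofReal |halfLine e u| * ENNReal.ofReal |halfLine e u|⁻¹ = 1 := by
    intro u
    have h0 : |halfLine e u| ≠ 0 := by
      simp [halfLine, he]
    rw [← ENNReal.ofReal_mul (abs_nonneg _), mul_inv_cancel₀ h0, ENNReal.ofReal_one]
  simp [this]

theorem measurable_halfLine (e : ℤˣ) : Measurable (halfLine e) := by unfold halfLine; fun_prop

theorem map_halfLine_le (e : ℤˣ) : Measure.map (halfLine e) volume ≤ kappa :=
  Measure.le_iff.2 fun s hs => by
    rw [map_halfLine_apply e s hs]; exact measure_mono Set.inter_subset_left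

theorem memLp_halfLine {n : ℕ} (e : ℤˣ) (F : L2B2 n) :
    MemLp (fun u => F (halfLine e u)) 2 volume :=
  ((Lp.memLp F).mono_measure (map_halfLine_le e)).comp_of_map (measurable_halfLine e).aemeasurable

/-- `F` on the half line of sign `ε`, in logarithmic coordinates. -/
def logCoord {n : ℕ} (e : ℤˣ) (F : L2B2 n) : Lp (B2 n) 2 (volume : Measure ℝ) :=
  (memLp_halfLine e F).toLp _

/-- The unitary Fourier transform `F̂(ν,j)`, `ν > 0`, `j = ±1`, on `L²(ℝ*, 𝓑₂; dκ)`: the continuous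
extension to `L²` of `F̂(ν,j) = 2^{-1/2} ∫ conj((ν,j)(λ)) F(λ) dκ(λ)`, see
`fourierT_ae_eq_integral`. The factor `2^{-1/2}` is what the Plancherel formula
`‖F‖² = ∑_j ∫ ‖F̂(ν,j)‖² dν/ν` with the counting measure on both copies of `{1,-1}` requires.
In logarithmic coordinates `F̂` is built from the `L²` Fourier transform on `ℝ`. -/
def fourierT {n : ℕ} (F : L2B2 n) (nu : ℝ) (j : ℤˣ) : B2 n :=
  ((Real.sqrt 2)⁻¹ : ℂ) • ∑ e : ℤˣ, signChar j e •
    (𝓕 (logCoord e F) : Lp (B2 n) 2 (volume : Measure ℝ)) (Real.log nu)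

/-- On `L¹ ∩ L²(ℝ)` the `L²` Fourier transform is given by the Fourier integral. -/
theorem fourier_coeFn_ae {E : Type} [NormedAddCommGroup E] [InnerProductSpace ℂ E]
    [CompleteSpace E] (F : Lp E 2 (volume : Measure ℝ)) (hF : Integrable F) :
    (𝓕 F : Lp E 2 (volume : Measure ℝ)) =ᵐ[volume] 𝓕 (F : ℝ → E) := by
  have hcont : Continuous (𝓕 (F : ℝ → E)) :=
    VectorFourier.fourierIntegral_continuous Real.continuous_fourierChar
      (innerSL ℝ).continuous₂ hF
  refine ae_eq_of_integral_contDiff_smul_eq ((Lp.memLp _).locallyIntegrable (by norm_num))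
    hcont.locallyIntegrable fun g hg hgc => ?_
  have hgc' : HasCompactSupport fun x => (g x : ℂ) := hgc.comp_left (g := ((↑) : ℝ → ℂ)) rfl
  set G : SchwartzMap ℝ ℂ := hgc'.toSchwartzMap (Complex.ofRealCLM.contDiff.comp hg) with hG
  have hGx : ∀ x, G x = (g x : ℂ) := fun x => rfl
  have h1 := congrArg (fun D => D G) (Lp.fourier_toTemperedDistribution_eq F)
  simp only [TemperedDistribution.fourier_apply, Lp.toTemperedDistribution_apply] at h1
  have h2 := VectorFourier.integral_fourierIntegral_smul_eq_flip (L := innerₗ ℝ) (μ := volume)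
    (ν := volume) (f := (G : ℝ → ℂ)) (g := (F : ℝ → E)) Real.continuous_fourierChar
    continuous_inner G.integrable hF
  calc ∫ x, g x • (𝓕 F : Lp E 2 (volume : Measure ℝ)) x
      = ∫ x, G x • (𝓕 F : Lp E 2 (volume : Measure ℝ)) x := by
        simp_rw [hGx, Complex.coe_smul]
    _ = ∫ x, (𝓕 G) x • F x := h1.symm
    _ = ∫ x, G x • (𝓕 (F : ℝ → E)) x := by
        rw [flip_innerₗ] at h2
        exact h2
    _ = _ := by simp_rw [hGx, Complex.coe_smul]

theorem kappa_eq : kappa = Measure.map (halfLine 1) volume + Measure.map (halfLine (-1)) volume := by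
  have hp : Set.range (halfLine 1) = Set.Ioi 0 := by
    ext x; constructor
    · rintro ⟨u, rfl⟩; simp [halfLine, Real.exp_pos]
    · intro hx; exact ⟨Real.log x, by simp [halfLine, Real.exp_log hx]⟩
  have hn : Set.range (halfLine (-1)) = Set.Iio 0 := by
    ext x; constructor
    · rintro ⟨u, rfl⟩; simp [halfLine, Real.exp_pos]
    · intro hx
      have hx' : 0 < -x := neg_pos.2 hx
      exact ⟨Real.log (-x), by rw [halfLine, Real.exp_log hx']; simp⟩
  ext s hs
  rw [Measure.add_apply, map_halfLine_apply 1 s hs, map_halfLine_apply (-1) s hs, hp, hn]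
  rw [← measure_union _ (hs.inter measurableSet_Iio)]
  · rw [← Set.inter_union_distrib_left]
    refine (measure_inter_conull ?_).symm
    have : (Set.Ioi (0:ℝ) ∪ Set.Iio 0)ᶜ = {0} := by
      ext x; simp [le_antisymm_iff]
    rw [this]
    exact withDensity_absolutelyContinuous _ _ Real.volume_singleton
  · exact (Set.disjoint_left.2 fun x hx hx' => lt_asymm (Set.mem_Ioi.1 hx.2) (Set.mem_Iio.1 hx'.2))

theorem dualChar_halfLine (nu : ℝ) (j e : ℤˣ) (u : ℝ) : dualChar nu j (halfLine e u) =
    Complex.exp ((2 * Real.pi * Real.log nu * u : ℝ) * Complex.I) * signChar j e := by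
  have h1 : |halfLine e u| = Real.exp u := by
    rcases Int.units_eq_one_or e with rfl | rfl <;> simp [halfLine]
  have h2 : realSign (halfLine e u) = e := by
    rcases Int.units_eq_one_or e with rfl | rfl
    · simp [halfLine, realSign, Real.exp_pos]
    · simp [halfLine, realSign, (Real.exp_pos u).le]
  rw [dualChar, h1, h2, Real.log_exp]

theorem measurable_dualChar (nu : ℝ) (j : ℤˣ) : Measurable (dualChar nu j) := by
  have : Measurable fun lam => signChar j (realSign lam) := by
    unfold realSign
    simp_rw [apply_ite (signChar j)]
    exact Measurable.ite measurableSet_Ioi measurable_const measurable_const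
  unfold dualChar
  have h2 : Measurable fun lam : ℝ => Complex.exp
    ((2 * Real.pi * Real.log nu * Real.log |lam| : ℝ) * Complex.I) := by fun_prop
  exact h2.mul this

theorem integral_dualChar {E : Type} [NormedAddCommGroup E] [NormedSpace ℂ E]
    {f : ℝ → E} (hf : Integrable f kappa) (nu : ℝ) (j : ℤˣ) :
    ∫ lam, (starRingEnd ℂ) (dualChar nu j lam) • f lam ∂kappa =
      ∑ e : ℤˣ, signChar j e • 𝓕 (fun u => f (halfLine e u)) (Real.log nu) := by
  have hI : Integrable (fun lam => (starRingEnd ℂ) (dualChar nu j lam) • f lam) kappa := by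
    refine hf.bdd_smul (C := 1) ?_ ?_
    · exact (Complex.continuous_conj.measurable.comp (measurable_dualChar nu j)).aestronglyMeasurable
    · refine Filter.Eventually.of_forall fun lam => ?_
      rw [RCLike.norm_conj, dualChar, norm_mul, Complex.norm_exp_ofReal_mul_I, one_mul, signChar]
      split_ifs
      · simp
      · rcases Int.units_eq_one_or (realSign lam) with h | h <;> simp [h]
  have hpart : ∀ e : ℤˣ, ∫ lam, (starRingEnd ℂ) (dualChar nu j lam) • f lam
      ∂(Measure.map (halfLine e) volume) =
      signChar j e • 𝓕 (fun u => f (halfLine e u)) (Real.log nu) := by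
    intro e
    rw [integral_map (measurable_halfLine e).aemeasurable
      (hI.mono_measure (map_halfLine_le e)).aestronglyMeasurable,
      Real.fourier_real_eq_integral_exp_smul, ← integral_smul]
    refine integral_congr_ae (Filter.Eventually.of_forall fun u => ?_)
    simp only [dualChar_halfLine, map_mul, smul_smul, ← Complex.exp_conj, Complex.conj_I,
      Complex.conj_ofReal]
    have hs : (starRingEnd ℂ) (signChar j e) = signChar j e := by
      unfold signChar; split_ifs <;> simp
    rw [hs, mul_comm]
    congr 3
    push_cast
    ring_nf
  rw [Fintype.sum_eq_add (1 : ℤˣ) (-1) (by decide)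
    (fun x hx => by rcases Int.units_eq_one_or x with h | h <;> simp [h] at hx),
    ← hpart, ← hpart, ← integral_add_measure (hI.mono_measure (map_halfLine_le 1))
    (hI.mono_measure (map_halfLine_le (-1))), ← kappa_eq]

theorem fourier_log_ae {E : Type} [NormedAddCommGroup E] [InnerProductSpace ℂ E]
    [CompleteSpace E] {f : ℝ → E} (hf : MemLp f 2 volume) (hf1 : Integrable f volume) :
    ∀ᵐ nu : ℝ, 0 < nu → (𝓕 hf.toLp : Lp E 2 (volume : Measure ℝ)) (Real.log nu) =
      𝓕 f (Real.log nu) := by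
  have h := fourier_coeFn_ae hf.toLp (hf1.congr hf.coeFn_toLp.symm)
  have hcg : 𝓕 (hf.toLp : ℝ → E) = 𝓕 f :=
    funext fun x => Real.fourier_congr_ae hf.coeFn_toLp x
  rw [hcg, Filter.EventuallyEq, ae_iff] at h
  rw [ae_iff]
  refine measure_mono_null ?_ (addHaar_image_eq_zero_of_differentiableOn_of_addHaar_eq_zero
    volume Real.differentiable_exp.differentiableOn h)
  intro nu hnu
  simp only [Set.mem_ofPred_eq, Classical.not_imp] at hnu
  exact ⟨Real.log nu, hnu.2, Real.exp_log hnu.1⟩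

/-- On `L¹ ∩ L²` the Fourier transform is given by the integral formula. -/
theorem fourierT_ae_eq_integral {n : ℕ} (F : L2B2 n) (hF : Integrable F kappa) (j : ℤˣ) :
    ∀ᵐ nu, 0 < nu → fourierT F nu j =
      ((Real.sqrt 2)⁻¹ : ℂ) • ∫ lam, (starRingEnd ℂ) (dualChar nu j lam) • F lam ∂kappa := by
  have hint : ∀ e, Integrable (fun u => F (halfLine e u)) volume := fun e =>
    (hF.mono_measure (map_halfLine_le e)).comp_measurable (measurable_halfLine e)
  filter_upwards [fourier_log_ae (memLp_halfLine 1 F) (hint 1),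
    fourier_log_ae (memLp_halfLine (-1) F) (hint (-1))] with nu hp hn hnu
  rw [fourierT, integral_dualChar hF]
  congr 1
  refine Finset.sum_congr rfl fun e _ => ?_
  congr 1
  rcases Int.units_eq_one_or e with rfl | rfl
  · exact hp hnu
  · exact hn hnu

/-! ### The Weyl transform -/

/-- `W(g) = T`, where `W(g) = ∫ g(x,y) π_1(x,y,0) dx dy` is the Weyl transform of
`g ∈ L²(ℝⁿ × ℝⁿ) = L²(ℂⁿ)`, the operator integral being taken in the weak sense:
`⟪ψ, W(g) φ⟫ = ∫ g(x,y) ⟪ψ, π_1(x,y,0) φ⟫ dx dy` for all `φ, ψ ∈ L²(ℝⁿ)`. The integrand is a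
product of two square integrable functions. -/
def IsWeylTransform {n : ℕ} (g : Lp ℂ 2 (volume : Measure (Vec n × Vec n))) (T : B2 n) : Prop :=
  ∀ φ ψ : L2Rn n, inner ℂ ψ (T.toCLM φ) =
    ∫ z : Vec n × Vec n, g z * inner ℂ ψ (schrodinger 1 z.1 z.2 0 φ)

open Classical in
/-- `W⁻¹(T)`: the unique `g ∈ L²(ℂⁿ)` with `W(g) = T`. (As `W` is a bijection of `L²(ℂⁿ)` onto `𝓑₂`,
the second alternative never occurs.) -/
def weylInv {n : ℕ} (T : B2 n) : Lp ℂ 2 (volume : Measure (Vec n × Vec n)) :=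
  if h : ∃ g, IsWeylTransform g T then h.choose else 0

/-! ### The Gabor system -/

/-- The indices `(k,l,m) ∈ ℤⁿ × ℤⁿ × ℤ = ℤ^{2n+1}`. -/
abbrev GaborIndex (n : ℕ) : Type := (Fin n → ℤ) × (Fin n → ℤ) × ℤ

/-- `𝒢_{k,l,m} = M_{a(2k,l,m)} 𝒢`, where `a(2k,l,m) = (2ak, al, am)`. -/
def modulated {n : ℕ} (a : ℝ) (G : L2B2 n) (q : GaborIndex n) : L2B2 n :=
  modulation (WithLp.toLp 2 fun i => 2 * a * (q.1 i : ℝ)) (WithLp.toLp 2 fun i => a * (q.2.1 i : ℝ))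
    (a * (q.2.2 : ℝ)) G

/-- The element `T_{e^{bp}} M_{a(2k,l,m)} 𝒢` of the Gabor system. -/
def gabor {n : ℕ} (a b : ℝ) (G : L2B2 n) (q : GaborIndex n) (p : ℤ) : L2B2 n :=
  translation (Real.exp (b * p)) (Real.exp_pos _).ne' (modulated a G q)

/-- `g_{k,l,m}(·,ν,j) ∈ L²(ℂⁿ)`, defined by `W(g_{k,l,m}(·,ν,j)) = 𝒢̂_{k,l,m}(ν,j)`. -/
def gaborSymbol {n : ℕ} (a : ℝ) (G : L2B2 n) (q : GaborIndex n) (nu : ℝ) (j : ℤˣ) :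
    Lp ℂ 2 (volume : Measure (Vec n × Vec n)) :=
  weylInv (fourierT (modulated a G q) nu j)

/-- `w_{g_{k,l,m}}(ν) = ∑_{j = ±1} ∑_{s ∈ ℤ} ‖g_{k,l,m}(·, ν e^{s/b}, j)‖²`, with values in `[0,∞]`. -/
def gaborWeight {n : ℕ} (a b : ℝ) (G : L2B2 n) (q : GaborIndex n) (nu : ℝ) : ℝ≥0∞ :=
  ∑ j : ℤˣ, ∑' s : ℤ, ‖gaborSymbol a G q (nu * Real.exp (s / b)) j‖ₑ ^ 2

/-- `Ω_{k,l,m} = {ν ∈ (1, e^{1/b}) : w_{g_{k,l,m}}(ν) ≠ 0}`. -/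
def gaborSupport {n : ℕ} (a b : ℝ) (G : L2B2 n) (q : GaborIndex n) : Set ℝ :=
  {nu | nu ∈ Set.Ioo 1 (Real.exp (1 / b)) ∧ gaborWeight a b G q nu ≠ 0}

/-- The family `f` is a Parseval frame for its closed linear span. -/
def IsParsevalFrameSequence {ι K : Type} [NormedAddCommGroup K] [InnerProductSpace ℂ K]
    (f : ι → K) : Prop :=
  ∀ x ∈ (Submodule.span ℂ (Set.range f)).topologicalClosure,
    HasSum (fun i => ‖inner ℂ x (f i)‖ ^ 2) (‖x‖ ^ 2)

end
end HeisenbergGabor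

open HeisenbergGabor

/-! A family is a Parseval frame for its closed span exactly when its Gram matrix `M` satisfies `M²
= M`, with entrywise convergent sums (`isParsevalFrameSequence_iff_gram`). The theorem thus becomes
a computation of Gram entries.

In logarithmic coordinates the dilation by `e^{bp}` is a shift by `bp`, hence multiplication by a
character on the Fourier side. Plancherel on `ℝ*` writes the Gram entries as integrals of
`e^{2πib(p-p')v}` against the inner products of the Fourier transforms at `ν = e^v` (`inner_gabor`).
The Weyl transform is isometric and onto `𝓑₂`, so orthogonality of the symbols is orthogonality of
the Fourier transforms. The blocks with distinct `(k,l,m)` therefore vanish (`inner_gabor_eq_zero`),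
and a block diagonal matrix is idempotent iff each block is (`hasSum_prod_mul_iff`).

The characters that occur have period `1/b`. Folding the integral onto one period makes each
diagonal block the Toeplitz matrix of Fourier coefficients of the weight `w(e^v)`
(`inner_gabor_self`). Such a matrix is idempotent iff `u = w/b` satisfies `u² = u` a.e., that is, `w
∈ {0, b}` a.e. (`hasSum_integral_expChar_iff`). A priori `w` is only integrable; its square
integrability is extracted from the idempotence relation itself.

The facts needed on the Weyl transform follow from Moyal's identity, which is Plancherel in one
variable, and from irreducibility, proved with a Gaussian whose matrix coefficient has no zeros. -/

namespace HeisenbergGabor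

/-! ### Parseval frame sequences and idempotent Gram matrices. -/

section Gram

variable {ι K : Type} [NormedAddCommGroup K] [InnerProductSpace ℂ K]

theorem norm_sq_eq_inner_mul_inner (x y : K) :
    ((‖inner ℂ x y‖ ^ 2 : ℝ) : ℂ) = inner ℂ x y * inner ℂ y x := by
  rw [← inner_conj_symm y x, RCLike.mul_conj]
  norm_cast

/-- Polarization of the Parseval identity. -/
theorem IsParsevalFrameSequence.hasSum_inner_mul_inner {f : ι → K}
    (h : IsParsevalFrameSequence f) {x y : K} (hx : x ∈ Submodule.span ℂ (Set.range f))
    (hy : y ∈ Submodule.span ℂ (Set.range f)) :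
    HasSum (fun k => inner ℂ x (f k) * inner ℂ (f k) y) (inner ℂ x y) := by
  have key : ∀ z ∈ Submodule.span ℂ (Set.range f),
      HasSum (fun k => ((‖inner ℂ (f k) z‖ : ℂ)) ^ 2) ((‖z‖ : ℂ) ^ 2) := fun z hz => by
    have := Complex.hasSum_ofReal.2 (h z (Submodule.le_topologicalClosure _ hz))
    simpa [norm_inner_symm z] using this
  have hI : Complex.I • y ∈ Submodule.span ℂ (Set.range f) := Submodule.smul_mem _ _ hy
  have h1 := key _ (Submodule.add_mem _ hx hy)
  have h2 := key _ (Submodule.sub_mem _ hx hy)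
  have h3 := key _ (Submodule.sub_mem _ hx hI)
  have h4 := key _ (Submodule.add_mem _ hx hI)
  have h5 := ((h1.sub h2).add ((h3.sub h4).mul_right Complex.I)).div_const 4
  rw [inner_eq_sum_norm_sq_div_four x y]
  convert! h5 using 2 with k
  -- The same polarization identity is applied to the scalars `⟪f k, x⟫` and `⟪f k, y⟫`, so it
  -- matches the four Parseval sums term by term.
  have e : inner ℂ x (f k) * inner ℂ (f k) y = inner ℂ (inner ℂ (f k) x) (inner ℂ (f k) y) := by
    rw [RCLike.inner_apply, inner_conj_symm, mul_comm]
  rw [e, inner_eq_sum_norm_sq_div_four (inner ℂ (f k) x)]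
  simp only [inner_add_right, inner_sub_right, inner_smul_right, RCLike.I_to_complex, smul_eq_mul]
  rfl

theorem hasSum_inner_mul_inner_of_mem_span {f : ι → K}
    (h : ∀ i j, HasSum (fun k => inner ℂ (f i) (f k) * inner ℂ (f k) (f j)) (inner ℂ (f i) (f j)))
    {x y : K} (hx : x ∈ Submodule.span ℂ (Set.range f))
    (hy : y ∈ Submodule.span ℂ (Set.range f)) :
    HasSum (fun k => inner ℂ x (f k) * inner ℂ (f k) y) (inner ℂ x y) := by
  induction hx using Submodule.span_induction with
  | zero => simp
  | add u v _ _ hu hv => simpa only [inner_add_left, add_mul] using hu.add hv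
  | smul c u _ hu =>
    simpa only [inner_smul_left, mul_assoc] using hu.mul_left ((starRingEnd ℂ) c)
  | mem u hu =>
    obtain ⟨i, rfl⟩ := hu
    induction hy using Submodule.span_induction with
    | zero => simp
    | add u v _ _ hu hv => simpa only [inner_add_right, mul_add] using hu.add hv
    | smul c u _ hu =>
      simpa only [inner_smul_right, mul_left_comm] using hu.mul_left c
    | mem u hu =>
      obtain ⟨j, rfl⟩ := hu
      exact h i j

/-- Necessity is polarization. Conversely, sesquilinearity carries the Gram relation to the span.
The closure is reached because the truncated analysis operators are contractions there, uniformly in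
the truncation. -/
theorem isParsevalFrameSequence_iff_gram (f : ι → K) : IsParsevalFrameSequence f ↔
    ∀ i j, HasSum (fun k => inner ℂ (f i) (f k) * inner ℂ (f k) (f j)) (inner ℂ (f i) (f j)) := by
  refine ⟨fun h i j => h.hasSum_inner_mul_inner (Submodule.subset_span ⟨i, rfl⟩)
    (Submodule.subset_span ⟨j, rfl⟩), fun h x hx => ?_⟩
  have hspan : ∀ y ∈ Submodule.span ℂ (Set.range f),
      HasSum (fun k => ‖inner ℂ y (f k)‖ ^ 2) (‖y‖ ^ 2) := fun y hy => by
    have := hasSum_inner_mul_inner_of_mem_span h hy hy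
    simp_rw [← norm_sq_eq_inner_mul_inner, inner_self_eq_norm_sq_to_K] at this
    exact Complex.hasSum_ofReal.1 (by simpa using this)
  -- The analysis operator truncated to `s`. With values in a Euclidean space, its norm obeys the
  -- triangle inequality, as the `ε/3` argument below requires.
  let L : (s : Finset ι) → K →ₗ[ℂ] EuclideanSpace ℂ s := fun s =>
    { toFun := fun z => WithLp.toLp 2 fun k => inner ℂ (f k) z
      map_add' := fun z w => by ext k; simp
      map_smul' := fun c z => by ext k; simp }
  have hL : ∀ s z, ‖L s z‖ ^ 2 = ∑ k ∈ s, ‖inner ℂ z (f k)‖ ^ 2 := fun s z => by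
    rw [EuclideanSpace.norm_sq_eq, ← Finset.sum_coe_sort s]
    simp [L, norm_inner_symm z]
  have hle : ∀ s, ∀ z ∈ (Submodule.span ℂ (Set.range f)).topologicalClosure, ‖L s z‖ ≤ ‖z‖ := by
    intro s z hz
    rw [← sq_le_sq₀ (norm_nonneg _) (norm_nonneg _), hL]
    refine closure_minimal (t := {z | ∑ k ∈ s, ‖inner ℂ z (f k)‖ ^ 2 ≤ ‖z‖ ^ 2})
      (fun y hy => sum_le_hasSum s (fun _ _ => by positivity) (hspan y hy))
      (isClosed_le (by fun_prop) (by fun_prop)) hz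
  have hlim : Filter.Tendsto (fun s => ‖L s x‖) Filter.atTop (nhds ‖x‖) := by
    rw [Metric.tendsto_nhds]
    intro ε hε
    obtain ⟨y, hy, hxy⟩ := Metric.mem_closure_iff.1 hx (ε / 3) (by positivity)
    have hy1 : Filter.Tendsto (fun s => ‖L s y‖) Filter.atTop (nhds ‖y‖) := by
      have := (hspan y hy : Filter.Tendsto _ _ _).sqrt
      simp_rw [SummationFilter.unconditional_filter, ← hL, Real.sqrt_sq (norm_nonneg _)] at this
      exact this
    filter_upwards [Metric.tendsto_nhds.1 hy1 (ε / 3) (by positivity)] with s hs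
    have h1 : |‖L s x‖ - ‖L s y‖| ≤ ‖x - y‖ := by
      refine (abs_norm_sub_norm_le _ _).trans ?_
      rw [← map_sub]
      exact hle s _ (Submodule.sub_mem _ hx (Submodule.le_topologicalClosure _ hy))
    have h2 := abs_norm_sub_norm_le x y
    rw [Real.dist_eq] at hs ⊢
    rw [dist_eq_norm] at hxy
    rw [abs_lt] at hs ⊢
    rw [abs_le] at h1 h2
    constructor <;> linarith [hs.1, hs.2, h1.1, h1.2, h2.1, h2.2]
  have := hlim.pow 2
  simp_rw [hL] at this
  exact this

end Gram

/-! ### Functions annihilated by a separating family. -/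

/-- A complex integrable function which is orthogonal to a conjugation invariant family separating
finite measures vanishes almost everywhere. -/
theorem ae_eq_zero_of_forall_integral_mul_eq_zero {α ι : Type} [MeasurableSpace α] {μ : Measure α}
    {f : α → ℂ} (hf : Integrable f μ) (e : ι → α → ℂ) (hm : ∀ i, Measurable (e i))
    (hb : ∀ i x, ‖e i x‖ ≤ 1) (hconj : ∀ i, ∃ j, ∀ x, e j x = (starRingEnd ℂ) (e i x))
    (hsep : ∀ P Q : Measure α, IsFiniteMeasure P → IsFiniteMeasure Q →
      (∀ i, ∫ x, e i x ∂P = ∫ x, e i x ∂Q) → P = Q)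
    (h0 : ∀ i, ∫ x, e i x * f x ∂μ = 0) : f =ᵐ[μ] 0 := by
  -- For real `r` the densities `r⁺` and `r⁻` define finite measures with equal integrals against
  -- every `e i`, hence equal measures. `ENNReal.ofReal` performs the truncation to the positive
  -- part.
  have real_case : ∀ r : α → ℝ, Integrable r μ → (∀ i, ∫ x, e i x * (r x : ℂ) ∂μ = 0) →
      r =ᵐ[μ] 0 := by
    intro r hr h
    have hPf : ∀ s : α → ℝ, Integrable s μ →
        IsFiniteMeasure (μ.withDensity fun x => ENNReal.ofReal (s x)) := fun s hs =>
      isFiniteMeasure_withDensity_ofReal hs.2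
    have hPi : ∀ s : α → ℝ, Integrable s μ → ∀ i,
        ∫ x, e i x ∂(μ.withDensity fun x => ENNReal.ofReal (s x)) =
          ∫ x, e i x * (max (s x) 0 : ℝ) ∂μ := fun s hs i => by
      rw [integral_withDensity_eq_integral_toReal_smul₀ hs.aemeasurable.ennreal_ofReal
        (Filter.Eventually.of_forall fun _ => ENNReal.ofReal_lt_top)]
      refine integral_congr_ae (Filter.Eventually.of_forall fun x => ?_)
      simp only [ENNReal.toReal_ofReal', Complex.real_smul]
      ring
    have hPQ := hsep _ _ (hPf r hr) (hPf _ hr.neg) fun i => by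
      rw [hPi r hr, hPi _ hr.neg, ← sub_eq_zero, ← integral_sub, ← h i]
      · refine integral_congr_ae (Filter.Eventually.of_forall fun x => ?_)
        have : max (r x) 0 - max (-r x) 0 = r x := max_zero_sub_max_neg_zero_eq_self _
        simp only [Pi.neg_apply]
        rw [← mul_sub, ← Complex.ofReal_sub, this]
      all_goals
        refine Integrable.bdd_mul (c := 1) ?_ (hm i).aestronglyMeasurable
          (Filter.Eventually.of_forall (hb i))
        first
        | exact hr.pos_part.ofReal
        | exact hr.neg.pos_part.ofReal
    rw [withDensity_eq_iff hr.aemeasurable.ennreal_ofReal hr.neg.aemeasurable.ennreal_ofReal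
      hr.lintegral_lt_top.ne] at hPQ
    filter_upwards [hPQ] with x hx
    by_contra hne
    simp only [Pi.neg_apply, Pi.zero_apply] at hx hne
    rcases lt_or_gt_of_ne hne with h | h
    · rw [ENNReal.ofReal_of_nonpos h.le, eq_comm, ENNReal.ofReal_eq_zero] at hx
      linarith
    · rw [ENNReal.ofReal_of_nonpos (neg_nonpos.2 h.le), ENNReal.ofReal_eq_zero] at hx
      linarith
  -- The `e i` are complex, so one cannot simply take real parts of `h0`. Conjugation invariance
  -- shows that the conjugate of `f` is annihilated too, hence also `Re f` and `Im f`.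
  have h0' : ∀ i, ∫ x, e i x * (starRingEnd ℂ) (f x) ∂μ = 0 := fun i => by
    obtain ⟨j, hj⟩ := hconj i
    have := congrArg (starRingEnd ℂ) (h0 j)
    rw [← integral_conj] at this
    simpa [hj] using this
  have hi : ∀ i, Integrable (fun x => e i x * f x) μ := fun i =>
    hf.bdd_mul (c := 1) (hm i).aestronglyMeasurable (Filter.Eventually.of_forall (hb i))
  have hcf : Integrable (fun x => (starRingEnd ℂ) (f x)) μ :=
    (Complex.conjCLE.toContinuousLinearMap.integrable_comp hf)
  have hi' : ∀ i, Integrable (fun x => e i x * (starRingEnd ℂ) (f x)) μ := fun i =>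
    hcf.bdd_mul (c := 1) (hm i).aestronglyMeasurable (Filter.Eventually.of_forall (hb i))
  have hre := real_case (fun x => (f x).re) hf.re fun i => by
    have : ∀ x, e i x * ((f x).re : ℂ) =
        (e i x * f x + e i x * (starRingEnd ℂ) (f x)) / 2 := fun x => by
      rw [← mul_add, Complex.add_conj]; push_cast; ring
    simp_rw [this]
    rw [integral_div, integral_add (hi i) (hi' i), h0, h0']
    simp
  have him := real_case (fun x => (f x).im) hf.im fun i => by
    have : ∀ x, e i x * ((f x).im : ℂ) =
        (e i x * f x - e i x * (starRingEnd ℂ) (f x)) / (2 * Complex.I) := fun x => by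
      rw [← mul_sub, Complex.sub_conj]; push_cast; field_simp
    simp_rw [this]
    rw [integral_div, integral_sub (hi i) (hi' i), h0, h0']
    simp
  filter_upwards [hre, him] with x h1 h2
  exact Complex.ext h1 h2

/-! ### Idempotent Fourier coefficients on the circle. -/

section Circle

variable {T : ℝ} [hT : Fact (0 < T)]

/-- Trigonometric polynomials form a point-separating star subalgebra, and such an algebra
determines finite measures on a Polish space. -/
theorem ext_of_integral_fourier_eq {P Q : Measure (AddCircle T)} [IsFiniteMeasure P]
    [IsFiniteMeasure Q] (h : ∀ n : ℤ, ∫ x, fourier n x ∂P = ∫ x, fourier n x ∂Q) : P = Q := by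
  refine ext_of_forall_mem_subalgebra_integral_eq_of_polish (𝕜 := ℂ)
    (A := (fourierSubalgebra (T := T)).comap
      (BoundedContinuousFunction.toContinuousMapStarₐ ℂ)) ?_ fun g hg => ?_
  · intro x y hxy
    obtain ⟨_, ⟨f, hf, rfl⟩, hne⟩ := fourierSubalgebra_separatesPoints hxy
    exact ⟨f, ⟨f, ⟨BoundedContinuousFunction.mkOfCompact f, hf, rfl⟩, rfl⟩, hne⟩
  · have hmem : (g : C(AddCircle T, ℂ)) ∈ Submodule.span ℂ (Set.range (@fourier T)) := by
      rw [← fourierSubalgebra_coe]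
      exact hg
    have key : ∀ f ∈ Submodule.span ℂ (Set.range (@fourier T)), ∫ x, f x ∂P = ∫ x, f x ∂Q := by
      intro f hf
      have hint : ∀ (R : Measure (AddCircle T)) [IsFiniteMeasure R] (f : C(AddCircle T, ℂ)),
          Integrable f R := fun R _ f =>
        f.continuous.integrable_of_hasCompactSupport (HasCompactSupport.of_compactSpace _)
      induction hf using Submodule.span_induction with
      | zero => simp
      | add u v _ _ hu hv =>
        simp only [ContinuousMap.add_apply]
        rw [integral_add (hint P u) (hint P v), integral_add (hint Q u) (hint Q v), hu, hv]
      | smul c u _ hu =>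
        simp only [ContinuousMap.smul_apply]
        rw [integral_smul, integral_smul, hu]
      | mem u hu =>
        obtain ⟨n, rfl⟩ := hu
        exact h n
    exact key _ hmem

theorem norm_fourier_apply {T : ℝ} (n : ℤ) (x : AddCircle T) : ‖fourier n x‖ = 1 := by
  rw [fourier_apply, Circle.norm_coe]

/-- An integrable function on the circle is determined by its Fourier coefficients. -/
theorem ae_eq_zero_of_fourierCoeff_eq_zero {u : AddCircle T → ℂ}
    (hu : Integrable u AddCircle.haarAddCircle) (h : ∀ n, fourierCoeff u n = 0) :
    u =ᵐ[AddCircle.haarAddCircle] 0 :=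
  ae_eq_zero_of_forall_integral_mul_eq_zero hu (fun n x => fourier n x)
    (fun n => (fourier n).continuous.measurable) (fun n x => (norm_fourier_apply n x).le)
    (fun n => ⟨-n, fun _ => fourier_neg⟩)
    (fun _ _ _ _ h => ext_of_integral_fourier_eq h)
    (fun n => by simpa [fourierCoeff] using h (-n))

theorem fourierCoeff_sub {u v : AddCircle T → ℂ} (hu : Integrable u AddCircle.haarAddCircle)
    (hv : Integrable v AddCircle.haarAddCircle) (n : ℤ) :
    fourierCoeff (u - v) n = fourierCoeff u n - fourierCoeff v n := by
  rw [fourierCoeff, fourierCoeff, fourierCoeff, ← integral_sub (hu.fourier_smul _) (hv.fourier_smul _)]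
  simp only [Pi.sub_apply, smul_sub]

theorem fourierCoeff_fourier_mul (u : AddCircle T → ℂ) (p k : ℤ) :
    fourierCoeff (fun x => fourier p x * u x) k = fourierCoeff u (k - p) := by
  refine integral_congr_ae (Filter.Eventually.of_forall fun x => ?_)
  simp only [smul_eq_mul]
  rw [← mul_assoc, ← fourier_add]
  congr 3
  ring

theorem memLp_fourier_mul {u : AddCircle T → ℂ} (hu : MemLp u 2 AddCircle.haarAddCircle) (p : ℤ) :
    MemLp (fun x => fourier p x * u x) 2 AddCircle.haarAddCircle :=
  hu.of_le ((fourier p).continuous.aestronglyMeasurable.mul hu.aestronglyMeasurable)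
    (Filter.Eventually.of_forall fun x => by
      rw [norm_mul, norm_fourier_apply, one_mul])

/-- Convolution of Fourier coefficients, for a real square integrable function. -/
theorem hasSum_fourierCoeff_mul {u : AddCircle T → ℂ} (hu : MemLp u 2 AddCircle.haarAddCircle)
    (hreal : ∀ x, (starRingEnd ℂ) (u x) = u x) (p q : ℤ) :
    HasSum (fun k => fourierCoeff u (k - p) * fourierCoeff u (q - k))
      (fourierCoeff (fun x => u x * u x) (q - p)) := by
  -- Parseval for `e_q u` and `e_p u`. Since `u` is real, their inner product is the integral of
  -- `e_{p-q} u²`, and `û(-k)` is the conjugate of `û(k)`.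
  have h := (fourierBasis (T := T)).hasSum_inner_mul_inner
    (memLp_fourier_mul hu q).toLp (memLp_fourier_mul hu p).toLp
  have hr : ∀ p k : ℤ, inner ℂ (fourierBasis k) (memLp_fourier_mul hu p).toLp =
      fourierCoeff u (k - p) := fun p k => by
    rw [← HilbertBasis.repr_apply_apply, fourierBasis_repr,
      fourierCoeff_congr_ae (MemLp.coeFn_toLp (memLp_fourier_mul hu p)), fourierCoeff_fourier_mul]
  have hc : ∀ k : ℤ, (starRingEnd ℂ) (fourierCoeff u k) = fourierCoeff u (-k) := fun k => by
    rw [fourierCoeff, fourierCoeff, ← integral_conj]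
    refine integral_congr_ae (Filter.Eventually.of_forall fun x => ?_)
    simp only [smul_eq_mul, map_mul, hreal, ← fourier_neg]
  have hl : ∀ k : ℤ, inner ℂ (memLp_fourier_mul hu q).toLp (fourierBasis k) =
      fourierCoeff u (q - k) := fun k => by
    rw [← inner_conj_symm, hr, hc, neg_sub]
  simp_rw [hl, hr] at h
  have hin : inner ℂ (memLp_fourier_mul hu q).toLp (memLp_fourier_mul hu p).toLp =
      fourierCoeff (fun x => u x * u x) (q - p) := by
    rw [L2.inner_def, fourierCoeff]
    refine integral_congr_ae ?_
    filter_upwards [MemLp.coeFn_toLp (memLp_fourier_mul hu p),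
      MemLp.coeFn_toLp (memLp_fourier_mul hu q)] with x hp hq
    rw [hp, hq, RCLike.inner_apply, map_mul, hreal, ← fourier_neg, neg_sub, sub_eq_add_neg,
      fourier_add, smul_eq_mul]
    ring
  rw [hin] at h
  simpa only [mul_comm] using h

/-- The Fourier coefficients of a real integrable function are an idempotent for convolution if
and only if the function is an idempotent. -/
theorem hasSum_fourierCoeff_mul_self_iff {u : AddCircle T → ℂ}
    (hu : Integrable u AddCircle.haarAddCircle) (hreal : ∀ x, (starRingEnd ℂ) (u x) = u x) :
    (∀ p q : ℤ, HasSum (fun k => fourierCoeff u (k - p) * fourierCoeff u (q - k))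
      (fourierCoeff u (q - p))) ↔
    ∀ᵐ x ∂AddCircle.haarAddCircle, u x * u x = u x := by
  constructor
  · intro h
    -- Only integrability of `u` is known so far. The relation at `p = q = 0` reads `∑ |û(k)|² =
    -- û(0)`, so Riesz–Fischer and uniqueness of coefficients put `u` in `L²`.
    have hs : Summable fun k => ‖fourierCoeff u k‖ ^ 2 := by
      have h0 := (h 0 0).summable.norm
      refine h0.congr fun k => ?_
      have : fourierCoeff u (0 - k) = (starRingEnd ℂ) (fourierCoeff u k) := by
        rw [fourierCoeff, fourierCoeff, ← integral_conj]
        refine integral_congr_ae (Filter.Eventually.of_forall fun x => ?_)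
        simp only [smul_eq_mul, map_mul, hreal, ← fourier_neg, zero_sub]
      rw [this, sub_zero, norm_mul, RCLike.norm_conj, sq]
    have hmem : Memℓp (fourierCoeff u) 2 := memℓp_gen (by simpa using hs)
    set v : Lp ℂ 2 (AddCircle.haarAddCircle (T := T)) :=
      (fourierBasis (T := T)).repr.symm ⟨fourierCoeff u, hmem⟩ with hv
    have hvc : ∀ n, fourierCoeff v n = fourierCoeff u n := fun n => by
      rw [← fourierBasis_repr, hv, LinearIsometryEquiv.apply_symm_apply]
    have hvi : Integrable v AddCircle.haarAddCircle := (Lp.memLp v).integrable (by norm_num)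
    have huv : u =ᵐ[AddCircle.haarAddCircle] v := by
      have := ae_eq_zero_of_fourierCoeff_eq_zero (hu.sub hvi) fun n => by
        rw [fourierCoeff_sub hu hvi, hvc, sub_self]
      filter_upwards [this] with x hx
      exact sub_eq_zero.1 hx
    have hu2 : MemLp u 2 AddCircle.haarAddCircle := (Lp.memLp v).ae_eq huv.symm
    have huu : Integrable (fun x => u x * u x) AddCircle.haarAddCircle := hu2.integrable_mul hu2
    have := ae_eq_zero_of_fourierCoeff_eq_zero (huu.sub hu) fun n => by
      rw [fourierCoeff_sub huu hu, sub_eq_zero]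
      simpa using (hasSum_fourierCoeff_mul hu2 hreal 0 n).unique (h 0 n)
    filter_upwards [this] with x hx
    exact sub_eq_zero.1 hx
  · intro h p q
    -- An idempotent function has values in `{0, 1}`, hence is bounded.
    have hu2 : MemLp u 2 AddCircle.haarAddCircle := by
      refine MemLp.of_bound hu.aestronglyMeasurable 1 ?_
      filter_upwards [h] with x hx
      by_cases h0 : u x = 0
      · simp [h0]
      · rw [mul_left_cancel₀ h0 (hx.trans (mul_one _).symm), norm_one]
    have := hasSum_fourierCoeff_mul hu2 hreal p q
    rwa [fourierCoeff_congr_ae h] at this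

end Circle

/-! ### Translation and the `L²` Fourier transform. -/

section Translation

variable {E : Type} [NormedAddCommGroup E] [InnerProductSpace ℂ E]

/-- The character `v ↦ e^{2πi c v}`. -/
noncomputable def expChar (c v : ℝ) : ℂ := Complex.exp ((2 * Real.pi * c * v : ℝ) * Complex.I)

theorem norm_expChar (c v : ℝ) : ‖expChar c v‖ = 1 := Complex.norm_exp_ofReal_mul_I _

theorem continuous_expChar (c : ℝ) : Continuous (expChar c) := by unfold expChar; fun_prop

theorem fourier_comp_sub_right (f : ℝ → E) (c v : ℝ) :
    𝓕 (fun u => f (u - c)) v = expChar (-c) v • 𝓕 f v := by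
  have h := integral_sub_right_eq_self (μ := volume)
    (fun u => Complex.exp ((-2 * Real.pi * (u + c) * v : ℝ) * Complex.I) • f u) c
  simp only [sub_add_cancel] at h
  rw [Real.fourier_real_eq_integral_exp_smul, Real.fourier_real_eq_integral_exp_smul, h,
    ← integral_smul]
  refine integral_congr_ae (Filter.Eventually.of_forall fun u => ?_)
  simp only [expChar, smul_smul, ← Complex.exp_add]
  congr 2
  push_cast
  ring

theorem memLp_expChar (c : ℝ) : MemLp (expChar c) ∞ (volume : Measure ℝ) :=
  memLp_top_of_bound (continuous_expChar c).aestronglyMeasurable 1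
    (Filter.Eventually.of_forall fun v => (norm_expChar c v).le)

/-- The `L²` Fourier transform turns translations into multiplication by characters. -/
theorem fourier_compMeasurePreserving_sub [CompleteSpace E] (c : ℝ) (F : Lp E 2 (volume : Measure ℝ)) :
    (𝓕 (Lp.compMeasurePreserving (fun u : ℝ => u - c) (measurePreserving_sub_right volume c) F :
      Lp E 2 (volume : Measure ℝ)) : Lp E 2 (volume : Measure ℝ)) =ᵐ[volume]
      fun v => expChar (-c) v • (𝓕 F : Lp E 2 (volume : Measure ℝ)) v := by
  -- Multiplication by the character, as a bounded operator on `L²`. Both sides are then continuous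
  -- in `F` and need comparing only on Schwartz functions, where the integral formula applies.
  set M := (ContinuousLinearMap.lsmul ℂ ℂ : ℂ →L[ℂ] E →L[ℂ] E).holderL
    (volume : Measure ℝ) ∞ 2 2 (memLp_expChar (-c)).toLp with hM
  have hMF : ∀ F : Lp E 2 (volume : Measure ℝ), M F =ᵐ[volume] fun v => expChar (-c) v • F v := by
    intro F
    refine ((ContinuousLinearMap.lsmul ℂ ℂ : ℂ →L[ℂ] E →L[ℂ] E).coeFn_holder (r := 2) _ F).trans ?_
    filter_upwards [MemLp.coeFn_toLp (memLp_expChar (-c))] with v hv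
    rw [hv]
    rfl
  refine Filter.EventuallyEq.trans ?_ (hMF _)
  have key : 𝓕 (Lp.compMeasurePreserving (fun u : ℝ => u - c)
      (measurePreserving_sub_right volume c) F : Lp E 2 (volume : Measure ℝ)) =
      M (𝓕 F : Lp E 2 (volume : Measure ℝ)) := ?_
  · rw [key]
  refine DenseRange.induction_on
    (SchwartzMap.denseRange_toLpCLM (E := ℝ) (F := E) (p := 2) (μ := volume) ENNReal.ofNat_ne_top) F ?_ ?_
  · refine isClosed_eq ?_ ?_
    · exact (Lp.fourierTransformₗᵢ ℝ E).continuous.comp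
        (Lp.isometry_compMeasurePreserving (measurePreserving_sub_right volume c)).continuous
    · exact M.continuous.comp (Lp.fourierTransformₗᵢ ℝ E).continuous
  · intro f
    set F : Lp E 2 (volume : Measure ℝ) := SchwartzMap.toLpCLM ℝ E 2 volume f with hF
    have hFf : F =ᵐ[volume] f := f.coeFn_toLp 2 volume
    have hFi : Integrable F volume := f.integrable.congr hFf.symm
    have hmp := measurePreserving_sub_right (volume : Measure ℝ) c
    have hτ := Lp.coeFn_compMeasurePreserving F hmp
    have hτi : Integrable (Lp.compMeasurePreserving (fun u : ℝ => u - c) hmp F) volume :=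
      (hmp.integrable_comp_of_integrable hFi).congr hτ.symm
    refine Lp.ext ?_
    filter_upwards [fourier_coeFn_ae _ hτi, fourier_coeFn_ae F hFi, hMF (𝓕 F)] with v h1 h2 h3
    rw [h1, h3, h2, Real.fourier_congr_ae hτ, ← fourier_comp_sub_right]
    rfl

end Translation

/-! ### Plancherel's formula on `ℝ*` in logarithmic coordinates. -/

variable {n : ℕ}

/-- Differentiable maps of the line send null sets to null sets; with `ae_of_comp_exp` this moves
a.e. statements between `ν > 0` and `v = log ν`. -/
theorem ae_comp_exp {P : ℝ → Prop} (h : ∀ᵐ nu : ℝ, 0 < nu → P nu) : ∀ᵐ v : ℝ, P (Real.exp v) := by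
  rw [ae_iff] at h ⊢
  have := addHaar_image_eq_zero_of_differentiableOn_of_addHaar_eq_zero (μ := volume)
    (f := Real.log) (s := {nu | ¬(0 < nu → P nu)})
    (fun x hx => (Real.differentiableAt_log (by
      simp only [Set.mem_ofPred_eq, Classical.not_imp] at hx
      exact hx.1.ne')).differentiableWithinAt) h
  refine measure_mono_null (fun v hv => ?_) this
  exact ⟨Real.exp v, by simpa [Real.exp_pos] using hv, Real.log_exp v⟩

theorem ae_of_comp_exp {P : ℝ → Prop} (h : ∀ᵐ v : ℝ, P (Real.exp v)) :
    ∀ᵐ nu : ℝ, 0 < nu → P nu := by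
  rw [ae_iff] at h ⊢
  have := addHaar_image_eq_zero_of_differentiableOn_of_addHaar_eq_zero
    volume Real.differentiable_exp.differentiableOn h
  refine measure_mono_null (fun nu hnu => ?_) this
  simp only [Set.mem_ofPred_eq, Classical.not_imp] at hnu
  exact ⟨Real.log nu, by simpa [Real.exp_log hnu.1] using hnu.2, Real.exp_log hnu.1⟩

theorem logCoord_translation (e : ℤˣ) (c : ℝ) (F : L2B2 n) :
    logCoord e (translation (Real.exp c) (Real.exp_pos _).ne' F) =
      Lp.compMeasurePreserving (fun u : ℝ => u - c) (measurePreserving_sub_right volume c)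
        (logCoord e F) := by
  have hq : Measure.QuasiMeasurePreserving (halfLine e) volume kappa :=
    ⟨measurable_halfLine e, (map_halfLine_le e).absolutelyContinuous⟩
  have hmp := measurePreserving_sub_right (volume : Measure ℝ) c
  refine Lp.ext ?_
  filter_upwards [MemLp.coeFn_toLp (memLp_halfLine e (translation (Real.exp c) (Real.exp_pos _).ne' F)),
    Lp.coeFn_compMeasurePreserving (logCoord e F) hmp,
    hmp.quasiMeasurePreserving.ae_eq_comp (MemLp.coeFn_toLp (memLp_halfLine e F)),
    hq.ae_eq_comp (Lp.coeFn_compMeasurePreserving F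
      (measurePreserving_div (Real.exp c) (Real.exp_pos _).ne'))]
    with u h1 h2 h3 h4
  rw [logCoord, h1, h2]
  refine Eq.trans ?_ h3.symm
  refine h4.trans ?_
  simp only [Function.comp_apply, halfLine, Real.exp_sub, mul_div_assoc]

theorem sum_units {M : Type} [AddCommMonoid M] (f : ℤˣ → M) : ∑ e, f e = f 1 + f (-1) := by
  rw [Fintype.sum_eq_add (1 : ℤˣ) (-1) (by decide)
    (fun x hx => by rcases Int.units_eq_one_or x with h | h <;> simp [h] at hx)]

theorem fourierT_translation (c : ℝ) (F : L2B2 n) (j : ℤˣ) :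
    ∀ᵐ v : ℝ, fourierT (translation (Real.exp c) (Real.exp_pos _).ne' F) (Real.exp v) j =
      expChar (-c) v • fourierT F (Real.exp v) j := by
  filter_upwards [fourier_compMeasurePreserving_sub c (logCoord 1 F),
    fourier_compMeasurePreserving_sub c (logCoord (-1) F)] with v h1 h2
  simp only [fourierT, Real.log_exp, logCoord_translation, sum_units]
  rw [h1, h2]
  module

/-- The character table of `{1,-1}` divided by `√2` is unitary, so passing from the signs `e` to the
characters `j` preserves the summed inner products. -/
theorem sum_inner_fourierT (F G : L2B2 n) (v : ℝ) :
    ∑ j, inner ℂ (fourierT F (Real.exp v) j) (fourierT G (Real.exp v) j) =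
      ∑ e, inner ℂ ((𝓕 (logCoord e F) : Lp (B2 n) 2 (volume : Measure ℝ)) v)
        ((𝓕 (logCoord e G) : Lp (B2 n) 2 (volume : Measure ℝ)) v) := by
  have hs : ((Real.sqrt 2 : ℝ) : ℂ)⁻¹ * ((Real.sqrt 2 : ℝ) : ℂ)⁻¹ = 1 / 2 := by
    rw [← mul_inv, ← Complex.ofReal_mul, Real.mul_self_sqrt (by norm_num)]
    norm_num
  simp only [sum_units, fourierT, Real.log_exp, signChar, inner_smul_left, inner_smul_right,
    inner_add_left, inner_add_right]
  simp
  linear_combination (2 * inner ℂ ((𝓕 (logCoord 1 F) : Lp (B2 n) 2 (volume : Measure ℝ)) v)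
        ((𝓕 (logCoord 1 G) : Lp (B2 n) 2 (volume : Measure ℝ)) v) +
      2 * inner ℂ ((𝓕 (logCoord (-1) F) : Lp (B2 n) 2 (volume : Measure ℝ)) v)
        ((𝓕 (logCoord (-1) G) : Lp (B2 n) 2 (volume : Measure ℝ)) v)) * hs

theorem inner_eq_sum_inner_logCoord (F G : L2B2 n) :
    inner ℂ F G = ∑ e, inner ℂ (logCoord e F) (logCoord e G) := by
  have hi := L2.integrable_inner (𝕜 := ℂ) F G
  have he : ∀ e, inner ℂ (logCoord e F) (logCoord e G) =
      ∫ lam, inner ℂ (F lam) (G lam) ∂(Measure.map (halfLine e) volume) := fun e => by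
    rw [L2.inner_def, integral_map (measurable_halfLine e).aemeasurable
      (hi.mono_measure (map_halfLine_le e)).aestronglyMeasurable]
    refine integral_congr_ae ?_
    filter_upwards [MemLp.coeFn_toLp (memLp_halfLine e F),
      MemLp.coeFn_toLp (memLp_halfLine e G)] with u h1 h2
    rw [logCoord, logCoord, h1, h2]
  rw [sum_units, he, he, ← integral_add_measure (hi.mono_measure (map_halfLine_le 1))
    (hi.mono_measure (map_halfLine_le (-1))), ← kappa_eq, L2.inner_def]

/-- Plancherel's formula on `ℝ*`. -/
theorem inner_eq_integral_fourierT (F G : L2B2 n) : inner ℂ F G =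
    ∫ v, ∑ j, inner ℂ (fourierT F (Real.exp v) j) (fourierT G (Real.exp v) j) := by
  simp_rw [sum_inner_fourierT]
  rw [integral_finsetSum _ fun e _ => L2.integrable_inner _ _, inner_eq_sum_inner_logCoord]
  refine Finset.sum_congr rfl fun e _ => ?_
  rw [← Lp.inner_fourier_eq, L2.inner_def]

theorem integrable_sum_inner_fourierT (F G : L2B2 n) : Integrable fun v : ℝ =>
    ∑ j, inner ℂ (fourierT F (Real.exp v) j) (fourierT G (Real.exp v) j) := by
  simp_rw [sum_inner_fourierT]
  exact integrable_finsetSum _ fun e _ => L2.integrable_inner _ _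

theorem inner_translation (c d : ℝ) (F G : L2B2 n) :
    inner ℂ (translation (Real.exp c) (Real.exp_pos _).ne' F)
      (translation (Real.exp d) (Real.exp_pos _).ne' G) =
    ∫ v, expChar (c - d) v *
      ∑ j, inner ℂ (fourierT F (Real.exp v) j) (fourierT G (Real.exp v) j) := by
  rw [inner_eq_integral_fourierT]
  refine integral_congr_ae ?_
  filter_upwards [fourierT_translation c F 1, fourierT_translation c F (-1),
    fourierT_translation d G 1, fourierT_translation d G (-1)] with v h1 h2 h3 h4
  have h : (starRingEnd ℂ) (expChar (-c) v) * expChar (-d) v = expChar (c - d) v := by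
    unfold expChar
    rw [← Complex.exp_conj, ← Complex.exp_add]
    congr 1
    simp only [map_mul, Complex.conj_ofReal, Complex.conj_I]
    push_cast
    ring
  rw [sum_units, sum_units, h1, h2, h3, h4, ← h]
  simp only [inner_smul_left, inner_smul_right]
  ring

/-! ### Plancherel's theorem for scalar functions on a Euclidean space. -/

section Plancherel

variable {V : Type} [NormedAddCommGroup V] [InnerProductSpace ℝ V] [FiniteDimensional ℝ V]
  [MeasurableSpace V] [BorelSpace V]

/-- On `L¹ ∩ L²` the `L²` Fourier transform is given by the Fourier integral. -/
theorem coeFn_fourier_ae_eq (F : Lp ℂ 2 (volume : Measure V)) (hF : Integrable F) :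
    (𝓕 F : Lp ℂ 2 (volume : Measure V)) =ᵐ[volume] 𝓕 (F : V → ℂ) := by
  have hcont : Continuous (𝓕 (F : V → ℂ)) :=
    VectorFourier.fourierIntegral_continuous Real.continuous_fourierChar
      (innerSL ℝ).continuous₂ hF
  refine ae_eq_of_integral_contDiff_smul_eq ((Lp.memLp _).locallyIntegrable (by norm_num))
    hcont.locallyIntegrable fun g hg hgc => ?_
  have hgc' : HasCompactSupport fun x => (g x : ℂ) := hgc.comp_left (g := ((↑) : ℝ → ℂ)) rfl
  set G : SchwartzMap V ℂ := hgc'.toSchwartzMap (Complex.ofRealCLM.contDiff.comp hg) with hG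
  have hGx : ∀ x, G x = (g x : ℂ) := fun x => rfl
  have h1 := congrArg (fun D => D G) (Lp.fourier_toTemperedDistribution_eq F)
  simp only [TemperedDistribution.fourier_apply, Lp.toTemperedDistribution_apply] at h1
  have h2 := VectorFourier.integral_fourierIntegral_smul_eq_flip (L := innerₗ V) (μ := volume)
    (ν := volume) (f := (G : V → ℂ)) (g := (F : V → ℂ)) Real.continuous_fourierChar
    continuous_inner G.integrable hF
  calc ∫ x, g x • (𝓕 F : Lp ℂ 2 (volume : Measure V)) x
      = ∫ x, G x • (𝓕 F : Lp ℂ 2 (volume : Measure V)) x := by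
        simp_rw [hGx, Complex.coe_smul]
    _ = ∫ x, (𝓕 G) x • F x := h1.symm
    _ = ∫ x, G x • (𝓕 (F : V → ℂ)) x := by
        rw [flip_innerₗ] at h2
        exact h2
    _ = _ := by simp_rw [hGx, Complex.coe_smul]

theorem enorm_sq_Lp_eq_lintegral {α E : Type} [MeasurableSpace α] [NormedAddCommGroup E]
    {μ : Measure α} (F : Lp E 2 μ) : ‖F‖ₑ ^ 2 = ∫⁻ x, ‖F x‖ₑ ^ 2 ∂μ := by
  rw [Lp.enorm_def, eLpNorm_eq_lintegral_rpow_enorm_toReal (by norm_num) (by norm_num)]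
  simp only [ENNReal.toReal_ofNat, ENNReal.rpow_ofNat]
  rw [← ENNReal.rpow_natCast, ← ENNReal.rpow_mul]
  norm_num

/-- Plancherel's theorem on `L¹ ∩ L²`. -/
theorem lintegral_enorm_fourier_sq {f : V → ℂ} (h1 : Integrable f) (h2 : MemLp f 2) :
    ∫⁻ x, ‖𝓕 f x‖ₑ ^ 2 = ∫⁻ x, ‖f x‖ₑ ^ 2 := by
  have e1 := enorm_sq_Lp_eq_lintegral h2.toLp
  have e2 := enorm_sq_Lp_eq_lintegral (𝓕 h2.toLp : Lp ℂ 2 (volume : Measure V))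
  have hn : ‖(𝓕 h2.toLp : Lp ℂ 2 (volume : Measure V))‖ₑ = ‖h2.toLp‖ₑ := by
    rw [← ofReal_norm, ← ofReal_norm, Lp.norm_fourier_eq]
  rw [hn, e1] at e2
  have hc := h2.coeFn_toLp
  have hF := coeFn_fourier_ae_eq h2.toLp (h1.congr hc.symm)
  calc ∫⁻ x, ‖𝓕 f x‖ₑ ^ 2 = ∫⁻ x, ‖(𝓕 h2.toLp : Lp ℂ 2 (volume : Measure V)) x‖ₑ ^ 2 := by
        refine lintegral_congr_ae ?_
        filter_upwards [hF] with x hx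
        rw [hx, Real.fourier_congr_ae hc]
    _ = ∫⁻ x, ‖(h2.toLp : V → ℂ) x‖ₑ ^ 2 := e2.symm
    _ = _ := by
        refine lintegral_congr_ae ?_
        filter_upwards [hc] with x hx
        rw [hx]

end Plancherel

/-! ### Matrix coefficients: Moyal's identity and irreducibility. -/

section Ambiguity

variable {n : ℕ}

/-- For fixed `y` the matrix coefficient is, up to a phase, a Fourier transform in `x`; this reduces
its `L²` norm to Plancherel. -/
theorem inner_schrodinger_eq_fourier (x y : Vec n) (φ ψ : L2Rn n) :
    inner ℂ (schrodinger 1 x y 0 φ) ψ =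
      Complex.exp ((-Real.pi * inner ℝ x y : ℝ) * Complex.I) *
        𝓕 (fun ξ => (starRingEnd ℂ) (φ (ξ + y)) * ψ ξ) x := by
  rw [L2.inner_def, Real.fourier_eq', ← integral_const_mul]
  refine integral_congr_ae ?_
  filter_upwards [coeFn_schrodinger 1 x y 0 φ] with ξ h
  rw [h, RCLike.inner_apply]
  simp only [map_mul, ← Complex.exp_conj, Complex.conj_I, Complex.conj_ofReal, smul_eq_mul]
  simp only [← mul_assoc, mul_comm (ψ ξ), ← Complex.exp_add]
  congr 3
  rw [real_inner_comm ξ x]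
  push_cast
  ring

theorem measurable_inner_schrodinger (φ ψ : L2Rn n) :
    StronglyMeasurable fun z : Vec n × Vec n => inner ℂ (schrodinger 1 z.1 z.2 0 φ) ψ := by
  simp_rw [inner_schrodinger_eq_fourier, Real.fourier_eq']
  have h1 : StronglyMeasurable fun z : Vec n × Vec n =>
      Complex.exp ((-Real.pi * inner ℝ z.1 z.2 : ℝ) * Complex.I) :=
    Continuous.stronglyMeasurable (by fun_prop)
  refine h1.mul (StronglyMeasurable.integral_prod_right (f := fun (z : Vec n × Vec n) ξ =>
    Complex.exp (↑(-2 * Real.pi * inner ℝ ξ z.1) * Complex.I) •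
      ((starRingEnd ℂ) (φ (ξ + z.2)) * ψ ξ)) ?_)
  have h2 : StronglyMeasurable fun p : (Vec n × Vec n) × Vec n =>
      Complex.exp (↑(-2 * Real.pi * inner ℝ p.2 p.1.1) * Complex.I) :=
    Continuous.stronglyMeasurable (by fun_prop)
  have h3 : StronglyMeasurable fun p : (Vec n × Vec n) × Vec n =>
      (starRingEnd ℂ) (φ (p.2 + p.1.2)) :=
    Complex.continuous_conj.comp_stronglyMeasurable
      ((Lp.stronglyMeasurable φ).comp_measurable (by fun_prop))
  have h4 : StronglyMeasurable fun p : (Vec n × Vec n) × Vec n => ψ p.2 :=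
    (Lp.stronglyMeasurable ψ).comp_measurable (by fun_prop)
  exact h2.smul (h3.mul h4)

/-- Plancherel in `x` for almost every `y`, then Tonelli and translation invariance. -/
theorem lintegral_enorm_inner_schrodinger_sq (φ ψ : L2Rn n) :
    ∫⁻ z : Vec n × Vec n, ‖inner ℂ (schrodinger 1 z.1 z.2 0 φ) ψ‖ₑ ^ 2 =
      ‖φ‖ₑ ^ 2 * ‖ψ‖ₑ ^ 2 := by
  have hφ := Lp.stronglyMeasurable φ
  have hψ := Lp.stronglyMeasurable ψ
  have hK : StronglyMeasurable fun p : Vec n × Vec n => (starRingEnd ℂ) (φ (p.2 + p.1)) * ψ p.2 :=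
    (Complex.continuous_conj.comp_stronglyMeasurable (hφ.comp_measurable (by fun_prop))).mul
      (hψ.comp_measurable (by fun_prop))
  have hK2 : ∫⁻ y, ∫⁻ ξ, ‖(starRingEnd ℂ) (φ (ξ + y)) * ψ ξ‖ₑ ^ 2 = ‖φ‖ₑ ^ 2 * ‖ψ‖ₑ ^ 2 := by
    rw [lintegral_lintegral_swap (hK.enorm.pow_const 2).aemeasurable]
    have : ∀ ξ : Vec n, ∫⁻ y, ‖(starRingEnd ℂ) (φ (ξ + y)) * ψ ξ‖ₑ ^ 2 =
        ‖φ‖ₑ ^ 2 * ‖ψ ξ‖ₑ ^ 2 := fun ξ => by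
      simp_rw [enorm_mul, mul_pow, RCLike.enorm_conj]
      rw [lintegral_mul_const _ (by fun_prop), lintegral_add_left_eq_self (fun y => ‖φ y‖ₑ ^ 2),
        ← enorm_sq_Lp_eq_lintegral]
    simp_rw [this]
    rw [lintegral_const_mul _ (by fun_prop), ← enorm_sq_Lp_eq_lintegral]
  rw [Measure.volume_eq_prod, lintegral_prod_symm _
    ((measurable_inner_schrodinger φ ψ).enorm.pow_const 2).aemeasurable, ← hK2]
  -- The product of two `L²` functions is in `L¹` for every `y`, but in `L²` only for almost every
  -- `y`.
  have hfin : ∀ᵐ y : Vec n, ∫⁻ ξ, ‖(starRingEnd ℂ) (φ (ξ + y)) * ψ ξ‖ₑ ^ 2 < ∞ := by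
    refine ae_lt_top (hK.enorm.pow_const 2).lintegral_prod_right' ?_
    rw [hK2]
    exact ENNReal.mul_ne_top (ENNReal.pow_ne_top enorm_ne_top) (ENNReal.pow_ne_top enorm_ne_top)
  refine lintegral_congr_ae ?_
  filter_upwards [hfin] with y hy
  have hm : AEStronglyMeasurable (fun ξ => (starRingEnd ℂ) (φ (ξ + y)) * ψ ξ) volume :=
    (hK.comp_measurable (measurable_prodMk_left (x := y))).aestronglyMeasurable
  have hL2 : MemLp (fun ξ => (starRingEnd ℂ) (φ (ξ + y)) * ψ ξ) 2 := by
    refine ⟨hm, ?_⟩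
    rw [eLpNorm_lt_top_iff_lintegral_rpow_enorm_lt_top (by norm_num) (by norm_num)]
    simpa using hy
  have hφy : MemLp (fun ξ => (starRingEnd ℂ) (φ (ξ + y))) 2 :=
    ((Lp.memLp φ).comp_measurePreserving (measurePreserving_add_right volume y)).star
  have hL1 : Integrable (fun ξ => (starRingEnd ℂ) (φ (ξ + y)) * ψ ξ) :=
    hφy.integrable_mul (Lp.memLp ψ)
  rw [← lintegral_enorm_fourier_sq hL1 hL2]
  refine lintegral_congr fun x => ?_
  rw [inner_schrodinger_eq_fourier, enorm_mul, ← ofReal_norm, Complex.norm_exp_ofReal_mul_I]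
  simp

theorem memLp_inner_schrodinger (φ ψ : L2Rn n) :
    MemLp (fun z : Vec n × Vec n => inner ℂ (schrodinger 1 z.1 z.2 0 φ) ψ) 2 volume := by
  refine ⟨(measurable_inner_schrodinger φ ψ).aestronglyMeasurable, ?_⟩
  rw [eLpNorm_lt_top_iff_lintegral_rpow_enorm_lt_top (by norm_num) (by norm_num)]
  simp only [ENNReal.toReal_ofNat, ENNReal.rpow_ofNat]
  rw [lintegral_enorm_inner_schrodinger_sq]
  exact ENNReal.mul_lt_top (ENNReal.pow_lt_top enorm_lt_top) (ENNReal.pow_lt_top enorm_lt_top)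

/-- The (conjugate) matrix coefficient `z ↦ ⟪π_1(z) φ, ψ⟫` of the Schrödinger representation. -/
noncomputable def ambiguity (φ ψ : L2Rn n) : Lp ℂ 2 (volume : Measure (Vec n × Vec n)) :=
  (memLp_inner_schrodinger φ ψ).toLp

theorem coeFn_ambiguity (φ ψ : L2Rn n) : ambiguity φ ψ =ᵐ[volume]
    fun z => inner ℂ (schrodinger 1 z.1 z.2 0 φ) ψ :=
  MemLp.coeFn_toLp _

theorem norm_ambiguity (φ ψ : L2Rn n) : ‖ambiguity φ ψ‖ = ‖φ‖ * ‖ψ‖ := by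
  have h : ‖ambiguity φ ψ‖ₑ ^ 2 = (‖φ‖ₑ * ‖ψ‖ₑ) ^ 2 := by
    rw [enorm_sq_Lp_eq_lintegral, mul_pow, ← lintegral_enorm_inner_schrodinger_sq]
    refine lintegral_congr_ae ?_
    filter_upwards [coeFn_ambiguity φ ψ] with z hz
    rw [hz]
  have h2 := (ENNReal.pow_right_strictMono (two_ne_zero)).injective h
  have h3 := congrArg ENNReal.toReal h2
  simpa [ENNReal.toReal_mul, toReal_enorm] using h3

theorem ambiguity_add_left (φ φ' ψ : L2Rn n) :
    ambiguity (φ + φ') ψ = ambiguity φ ψ + ambiguity φ' ψ := by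
  rw [ambiguity, ambiguity, ambiguity, ← MemLp.toLp_add]
  exact MemLp.toLp_congr _ _ (Filter.Eventually.of_forall fun z => by
    simp [map_add, inner_add_left])

theorem ambiguity_add_right (φ ψ ψ' : L2Rn n) :
    ambiguity φ (ψ + ψ') = ambiguity φ ψ + ambiguity φ ψ' := by
  rw [ambiguity, ambiguity, ambiguity, ← MemLp.toLp_add]
  exact MemLp.toLp_congr _ _ (Filter.Eventually.of_forall fun z => by simp [inner_add_right])

theorem ambiguity_smul_left (c : ℂ) (φ ψ : L2Rn n) :
    ambiguity (c • φ) ψ = (starRingEnd ℂ) c • ambiguity φ ψ := by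
  rw [ambiguity, ambiguity, ← MemLp.toLp_const_smul]
  exact MemLp.toLp_congr _ _ (Filter.Eventually.of_forall fun z => by
    simp only [map_smul, inner_smul_left, Pi.smul_apply, smul_eq_mul])

theorem ambiguity_smul_right (c : ℂ) (φ ψ : L2Rn n) :
    ambiguity φ (c • ψ) = c • ambiguity φ ψ := by
  rw [ambiguity, ambiguity, ← MemLp.toLp_const_smul]
  exact MemLp.toLp_congr _ _ (Filter.Eventually.of_forall fun z => by
    simp only [inner_smul_right, Pi.smul_apply, smul_eq_mul])

theorem inner_ambiguity_self_left (φ ψ ψ' : L2Rn n) :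
    inner ℂ (ambiguity φ ψ) (ambiguity φ ψ') = inner ℂ φ φ * inner ℂ ψ ψ' := by
  rw [inner_eq_sum_norm_sq_div_four, inner_eq_sum_norm_sq_div_four ψ,
    inner_self_eq_norm_sq_to_K]
  have e1 : ∀ c : ℂ, ‖ambiguity φ ψ + c • ambiguity φ ψ'‖ = ‖φ‖ * ‖ψ + c • ψ'‖ := fun c => by
    rw [← norm_ambiguity, ambiguity_add_right, ambiguity_smul_right]
  have h1 := e1 1
  have h2 := e1 (-1)
  have h3 := e1 Complex.I
  have h4 := e1 (-Complex.I)
  simp only [one_smul, neg_smul, ← sub_eq_add_neg] at h1 h2 h3 h4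
  simp only [RCLike.I_to_complex, h1, h2, h3, h4]
  push_cast
  ring

/-- Moyal's identity. -/
theorem inner_ambiguity (φ φ' ψ ψ' : L2Rn n) :
    inner ℂ (ambiguity φ ψ) (ambiguity φ' ψ') = inner ℂ φ' φ * inner ℂ ψ ψ' := by
  -- Polarization in the first slot: the combination with `φ + iφ'` cancels the cross term that has
  -- `φ` and `φ'` exchanged.
  have h1 := inner_ambiguity_self_left (φ + φ') ψ ψ'
  have h2 := inner_ambiguity_self_left (φ + Complex.I • φ') ψ ψ'
  simp only [ambiguity_add_left, ambiguity_smul_left, inner_add_left, inner_add_right,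
    inner_smul_left, inner_smul_right, inner_ambiguity_self_left, Complex.conj_I, map_neg] at h1 h2
  have hI := Complex.I_mul_I
  linear_combination (1 / 2) * h1 + (Complex.I / 2) * h2 + (1 / 2) *
    (inner ℂ (ambiguity φ ψ) (ambiguity φ' ψ') - inner ℂ (ambiguity φ' ψ) (ambiguity φ ψ') +
      (inner ℂ φ φ' - inner ℂ φ' φ) * inner ℂ ψ ψ') * hI

/-- Schrödinger operators commute up to the symplectic character. -/
theorem schrodinger_comm (x y x' y' : Vec n) (φ : L2Rn n) :
    schrodinger 1 x y 0 (schrodinger 1 x' y' 0 φ) =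
      Complex.exp ((2 * Real.pi * (inner ℝ x' y - inner ℝ x y') : ℝ) * Complex.I) •
        schrodinger 1 x' y' 0 (schrodinger 1 x y 0 φ) := by
  refine Lp.ext ?_
  have hy := (measurePreserving_add_right (volume : Measure (Vec n)) y).quasiMeasurePreserving
  have hy' := (measurePreserving_add_right (volume : Measure (Vec n)) y').quasiMeasurePreserving
  filter_upwards [coeFn_schrodinger 1 x y 0 (schrodinger 1 x' y' 0 φ),
    coeFn_schrodinger 1 x' y' 0 (schrodinger 1 x y 0 φ),
    hy.ae_eq_comp (coeFn_schrodinger 1 x' y' 0 φ), hy'.ae_eq_comp (coeFn_schrodinger 1 x y 0 φ),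
    Lp.coeFn_smul (Complex.exp ((2 * Real.pi * (inner ℝ x' y - inner ℝ x y') : ℝ) * Complex.I))
      (schrodinger 1 x' y' 0 (schrodinger 1 x y 0 φ))] with ξ h1 h2 h3 h4 h5
  simp only [Function.comp_apply] at h3 h4
  rw [h5, Pi.smul_apply, h1, h2, h3, h4, smul_eq_mul, add_right_comm ξ y' y]
  simp only [← mul_assoc, ← Complex.exp_add, inner_add_right]
  congr 2
  push_cast
  ring

/-- The symplectic form on `ℝⁿ × ℝⁿ`. -/
noncomputable def symplecticForm (n : ℕ) :
    (Vec n × Vec n) →ₗ[ℝ] (Vec n × Vec n) →ₗ[ℝ] ℝ :=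
  LinearMap.mk₂ ℝ (fun z w => inner ℝ w.1 z.2 - inner ℝ z.1 w.2)
    (fun z z' w => by simp only [Prod.fst_add, Prod.snd_add, inner_add_left, inner_add_right]; ring)
    (fun c z w => by
      simp only [Prod.smul_fst, Prod.smul_snd, inner_smul_left, inner_smul_right, smul_eq_mul]
      simp; ring)
    (fun z w w' => by simp only [Prod.fst_add, Prod.snd_add, inner_add_left, inner_add_right]; ring)
    (fun c z w => by
      simp only [Prod.smul_fst, Prod.smul_snd, inner_smul_left, inner_smul_right, smul_eq_mul]
      simp; ring)

theorem symplecticForm_apply (z w : Vec n × Vec n) :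
    symplecticForm n z w = inner ℝ w.1 z.2 - inner ℝ z.1 w.2 := rfl

theorem continuous_symplecticForm :
    Continuous fun p : (Vec n × Vec n) × (Vec n × Vec n) => symplecticForm n p.1 p.2 := by
  simp_rw [symplecticForm_apply]
  fun_prop

theorem symplecticForm_ne_zero (z : Vec n × Vec n) (hz : z ≠ 0) : symplecticForm n z ≠ 0 := by
  intro h
  -- At this vector the form equals `‖z.1‖² + ‖z.2‖²`.
  have h1 := congrArg (fun l => l (z.2, -z.1)) h
  simp only [symplecticForm_apply, inner_neg_right, LinearMap.zero_apply, sub_neg_eq_add] at h1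
  rw [real_inner_self_eq_norm_sq, real_inner_self_eq_norm_sq] at h1
  refine hz (Prod.ext (norm_eq_zero.1 ?_) (norm_eq_zero.1 ?_)) <;>
    nlinarith [sq_nonneg ‖z.1‖, sq_nonneg ‖z.2‖]

theorem ext_of_integral_symplectic_eq {P Q : Measure (Vec n × Vec n)} [IsFiniteMeasure P]
    [IsFiniteMeasure Q] (h : ∀ w, ∫ z, (Real.fourierChar (symplecticForm n z w) : ℂ) ∂P =
      ∫ z, (Real.fourierChar (symplecticForm n z w) : ℂ) ∂Q) : P = Q :=
  ext_of_integral_char_eq Real.continuous_fourierChar Real.fourierChar_ne_one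
    symplecticForm_ne_zero continuous_symplecticForm h

/-- Moving both vectors by `π_1(w)` multiplies the matrix coefficient by a symplectic character of
`z`. One pair of vectors thus yields the whole symplectic Fourier transform of a coefficient times
`g`. -/
theorem inner_schrodinger_schrodinger (z w : Vec n × Vec n) (φ ψ : L2Rn n) :
    inner ℂ (schrodinger 1 z.1 z.2 0 (schrodinger 1 w.1 w.2 0 φ)) (schrodinger 1 w.1 w.2 0 ψ) =
      (starRingEnd ℂ) (Real.fourierChar (symplecticForm n z w) : ℂ) *
        inner ℂ (schrodinger 1 z.1 z.2 0 φ) ψ := by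
  rw [schrodinger_comm, inner_smul_left]
  congr 1
  exact LinearIsometry.inner_map_map ((mulUnimodular (schrodingerPhase 1 w.1 w.2 0)
      (continuous_schrodingerPhase 1 w.1 w.2 0)
      (norm_schrodingerPhase 1 w.1 w.2 0)).comp
    (Lp.compMeasurePreservingₗᵢ ℂ (fun ξ : Vec n => ξ + w.2)
      (measurePreserving_add_right volume w.2))) _ _

theorem continuous_gaussian : Continuous fun ξ : Vec n => Complex.exp (-1 * (‖ξ‖ : ℂ) ^ 2) := by
  fun_prop

theorem memLp_gaussian : MemLp (fun ξ : Vec n => Complex.exp (-1 * (‖ξ‖ : ℂ) ^ 2)) 2 volume := by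
  rw [memLp_two_iff_integrable_sq_norm continuous_gaussian.aestronglyMeasurable]
  have h := (GaussianFourier.integrable_cexp_neg_mul_sq_norm_add (b := 2) (by norm_num) 0
    (0 : Vec n)).norm
  refine h.congr (Filter.Eventually.of_forall fun ξ => ?_)
  simp only
  rw [← norm_pow, ← Complex.exp_nat_mul]
  congr 2
  push_cast
  ring

theorem inner_schrodinger_gaussian_ne_zero (x y : Vec n) :
    inner ℂ (schrodinger 1 x y 0 memLp_gaussian.toLp) memLp_gaussian.toLp ≠ 0 := by
  rw [inner_schrodinger_eq_fourier]
  refine mul_ne_zero (Complex.exp_ne_zero _) ?_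
  have hg := MemLp.coeFn_toLp (memLp_gaussian (n := n))
  have hgy := (measurePreserving_add_right
    (volume : Measure (Vec n)) y).quasiMeasurePreserving.ae_eq_comp hg
  have h1 : 𝓕 (fun ξ : Vec n => (starRingEnd ℂ)
      (memLp_gaussian.toLp (μ := volume) (fun ξ : Vec n => Complex.exp (-1 * (‖ξ‖ : ℂ) ^ 2)) (ξ + y)) *
        memLp_gaussian.toLp (μ := volume) (fun ξ : Vec n => Complex.exp (-1 * (‖ξ‖ : ℂ) ^ 2)) ξ) x =
      -- Completing the square: `‖ξ + y‖² + ‖ξ‖² = 2‖ξ + y/2‖² + ‖y‖²/2`; recentring the Fourier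
      -- phase at `-y/2` produces `e^{πi x·y}`.
      ∫ ξ : Vec n, Complex.exp (-(‖y‖ : ℂ) ^ 2 / 2 + (Real.pi * Complex.I) * inner ℝ x y) *
        Complex.exp (-2 * (‖ξ + (1 / 2 : ℝ) • y‖ : ℂ) ^ 2 +
          (-2 * Real.pi * Complex.I) * inner ℝ x (ξ + (1 / 2 : ℝ) • y)) := by
    rw [Real.fourier_eq']
    refine integral_congr_ae ?_
    filter_upwards [hg, hgy] with ξ e1 e2
    simp only [Function.comp_apply] at e2
    rw [e1, e2, ← Complex.exp_conj, smul_eq_mul, ← Complex.exp_add, ← Complex.exp_add, ← Complex.exp_add]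
    congr 1
    simp only [map_mul, map_neg, map_one, Complex.conj_ofReal, ← Complex.ofReal_pow,
      norm_add_sq_real, norm_smul, inner_smul_right, inner_add_right, mul_pow]
    rw [real_inner_comm x ξ]
    push_cast
    simp
    ring
  rw [h1, integral_const_mul]
  refine mul_ne_zero (Complex.exp_ne_zero _) ?_
  rw [integral_add_right_eq_self (fun ξ : Vec n => Complex.exp (-2 * (‖ξ‖ : ℂ) ^ 2 +
      (-2 * Real.pi * Complex.I) * inner ℝ x ξ)),
    GaussianFourier.integral_cexp_neg_mul_sq_norm_add (by norm_num)]
  refine mul_ne_zero ?_ (Complex.exp_ne_zero _)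
  rw [Complex.cpow_def_of_ne_zero (by simp [Real.pi_ne_zero])]
  exact Complex.exp_ne_zero _

/-- Irreducibility of the Schrödinger representation, in its square integrable form. -/
theorem eq_zero_of_inner_ambiguity_eq_zero (g : Lp ℂ 2 (volume : Measure (Vec n × Vec n)))
    (h : ∀ φ ψ : L2Rn n, inner ℂ (ambiguity φ ψ) g = 0) : g = 0 := by
  -- Testing on `π_1(w)γ` in both slots for all `w` kills the symplectic Fourier transform of the
  -- integrable function `g · conj A`. It vanishes a.e., and `A` has no zeros.
  set γ : L2Rn n := memLp_gaussian.toLp with hγ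
  set A : Vec n × Vec n → ℂ := fun z => inner ℂ (schrodinger 1 z.1 z.2 0 γ) γ with hA
  have hi : Integrable (fun z => inner ℂ (A z) (g z)) volume :=
    (L2.integrable_inner (𝕜 := ℂ) (ambiguity γ γ) g).congr (by
      filter_upwards [coeFn_ambiguity γ γ] with z hz
      rw [hz])
  have h0 := ae_eq_zero_of_forall_integral_mul_eq_zero hi
    (fun w z => (Real.fourierChar (symplecticForm n z w) : ℂ))
    (fun w => by
      have := continuous_symplecticForm.comp (continuous_id.prodMk (continuous_const (y := w)))
      exact (continuous_induced_dom.comp (Real.continuous_fourierChar.comp this)).measurable)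
    (fun w z => (Circle.norm_coe _).le)
    (fun w => ⟨-w, fun z => by rw [map_neg, AddChar.map_neg_eq_inv, Circle.coe_inv_eq_conj]⟩)
    (fun P Q _ _ hPQ => ext_of_integral_symplectic_eq hPQ)
    (fun w => by
      rw [← h (schrodinger 1 w.1 w.2 0 γ) (schrodinger 1 w.1 w.2 0 γ), L2.inner_def]
      refine integral_congr_ae ?_
      filter_upwards [coeFn_ambiguity (schrodinger 1 w.1 w.2 0 γ) (schrodinger 1 w.1 w.2 0 γ)]
        with z hz
      rw [hz, inner_schrodinger_schrodinger, RCLike.inner_apply, RCLike.inner_apply, map_mul,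
        Complex.conj_conj]
      ring)
  refine Lp.ext ?_
  filter_upwards [h0, Lp.coeFn_zero ℂ 2 (volume : Measure (Vec n × Vec n))] with z hz hz0
  rw [hz0, Pi.zero_apply]
  rw [RCLike.inner_apply, Pi.zero_apply, mul_eq_zero] at hz
  refine hz.resolve_right ?_
  rw [map_eq_zero]
  exact inner_schrodinger_gaussian_ne_zero z.1 z.2

end Ambiguity

/-! ### The Weyl transform is an isometry onto the Hilbert–Schmidt operators. -/

section Weyl

variable {n : ℕ}

/-- The Weyl transform of a square integrable function, as a bounded operator. -/
noncomputable def weylCLM (g : Lp ℂ 2 (volume : Measure (Vec n × Vec n))) : L2Rn n →L[ℂ] L2Rn n :=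
  LinearMap.mkContinuous
    -- Riesz representation of the functional `ψ ↦ ⟪g, ambiguity φ ψ⟫`, bounded by Cauchy–Schwarz
    -- and `norm_ambiguity`.
    { toFun := fun φ => (InnerProductSpace.toDual ℂ (L2Rn n)).symm (LinearMap.mkContinuous
        (σ := RingHom.id ℂ)
        { toFun := fun ψ => (inner ℂ g (ambiguity φ ψ) : ℂ)
          map_add' := fun ψ ψ' => by rw [ambiguity_add_right, inner_add_right]
          map_smul' := fun c ψ => by rw [ambiguity_smul_right, inner_smul_right]; rfl }
        (‖g‖ * ‖φ‖) fun ψ => by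
          rw [mul_assoc, ← norm_ambiguity]
          exact norm_inner_le_norm (𝕜 := ℂ) g (ambiguity φ ψ))
      map_add' := fun φ φ' => by
        refine ext_inner_right ℂ fun ψ => ?_
        simp [InnerProductSpace.toDual_symm_apply, inner_add_left, ambiguity_add_left,
          inner_add_right]
      map_smul' := fun c φ => by
        refine ext_inner_right ℂ fun ψ => ?_
        simp [InnerProductSpace.toDual_symm_apply, inner_smul_left, ambiguity_smul_left,
          inner_smul_right] }
    ‖g‖ fun φ => by
      simp only [LinearMap.coe_mk, AddHom.coe_mk, LinearIsometryEquiv.norm_map]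
      exact LinearMap.mkContinuous_norm_le _ (by positivity) _

theorem inner_weylCLM (g : Lp ℂ 2 (volume : Measure (Vec n × Vec n))) (φ ψ : L2Rn n) :
    inner ℂ ψ (weylCLM g φ) = inner ℂ (ambiguity φ ψ) g := by
  rw [← inner_conj_symm, ← inner_conj_symm (ambiguity φ ψ)]
  congr 1
  exact InnerProductSpace.toDual_symm_apply

theorem isWeylTransform_iff (g : Lp ℂ 2 (volume : Measure (Vec n × Vec n))) (T : B2 n) :
    IsWeylTransform g T ↔ T.toCLM = weylCLM g := by
  have h : ∀ φ ψ : L2Rn n, ∫ z : Vec n × Vec n, g z * inner ℂ ψ (schrodinger 1 z.1 z.2 0 φ) =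
      inner ℂ ψ (weylCLM g φ) := fun φ ψ => by
    rw [inner_weylCLM, L2.inner_def]
    refine integral_congr_ae ?_
    filter_upwards [coeFn_ambiguity φ ψ] with z hz
    rw [hz, RCLike.inner_apply, inner_conj_symm]
  constructor
  · intro hg
    ext1 φ
    refine ext_inner_left ℂ fun ψ => ?_
    rw [hg φ ψ, h]
  · intro hT φ ψ
    rw [h, hT]

theorem clm_ext_of_hilbertBasis {ι H : Type} [NormedAddCommGroup H] [InnerProductSpace ℂ H]
    (e : HilbertBasis ι ℂ H) {A B : H →L[ℂ] H}
    (h : ∀ i k, inner ℂ (e k) (A (e i)) = inner ℂ (e k) (B (e i))) : A = B := by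
  have hd : Dense (Submodule.span ℂ (Set.range e) : Set H) :=
    (Submodule.dense_iff_topologicalClosure_eq_top).2 e.dense_span
  refine ContinuousLinearMap.ext_on hd ?_
  rintro _ ⟨i, rfl⟩
  refine e.repr.injective (lp.ext (funext fun k => ?_))
  rw [e.repr_apply_apply, e.repr_apply_apply, h]

/-- The matrix coefficients of the Schrödinger representation with respect to an orthonormal basis
form an orthonormal basis of `L²(ℝⁿ × ℝⁿ)`. -/
noncomputable def ambiguityBasis {ι : Type} (e : HilbertBasis ι ℂ (L2Rn n)) :
    HilbertBasis (ι × ι) ℂ (Lp ℂ 2 (volume : Measure (Vec n × Vec n))) :=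
  HilbertBasis.mkOfOrthogonalEqBot (v := fun p : ι × ι => ambiguity (e p.1) (e p.2))
    (by
      classical
      rw [orthonormal_iff_ite]
      rintro ⟨i, k⟩ ⟨i', k'⟩
      have he := orthonormal_iff_ite.1 e.orthonormal
      rw [inner_ambiguity, he, he, ite_zero_mul_ite_zero, mul_one]
      simp only [Prod.mk.injEq, eq_comm])
    (by
      rw [Submodule.eq_bot_iff]
      intro g hg
      -- The coefficients of `g` are the matrix entries of `weylCLM g`; if all vanish, so does the
      -- operator, and irreducibility gives `g = 0`.
      have h0 : weylCLM g = 0 := clm_ext_of_hilbertBasis e fun i k => by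
        rw [inner_weylCLM]
        simpa using (Submodule.mem_orthogonal _ g).1 hg _ (Submodule.subset_span ⟨(i, k), rfl⟩)
      refine eq_zero_of_inner_ambiguity_eq_zero g fun φ ψ => ?_
      rw [← inner_weylCLM, h0]
      simp)

theorem ambiguityBasis_apply {ι : Type} (e : HilbertBasis ι ℂ (L2Rn n)) (p : ι × ι) :
    ambiguityBasis e p = ambiguity (e p.1) (e p.2) := by
  rw [ambiguityBasis, HilbertBasis.coe_mkOfOrthogonalEqBot]

/-- The Weyl transform is onto the Hilbert-Schmidt operators. -/
theorem exists_isWeylTransform (T : B2 n) : ∃ g, IsWeylTransform g T := by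
  set e := basis (L2Rn n)
  -- The matrix entries of a Hilbert–Schmidt operator are square summable, so they can be prescribed
  -- as coefficients in `ambiguityBasis`.
  have hs : Summable fun p : basisIndex (L2Rn n) × basisIndex (L2Rn n) =>
      ‖inner ℂ (e p.2) (T.toCLM (e p.1))‖ ^ 2 := by
    have hrow : ∀ i, HasSum (fun k => ‖inner ℂ (e k) (T.toCLM (e i))‖ ^ 2) (‖T.toCLM (e i)‖ ^ 2) :=
      fun i => by
        have h := lp.hasSum_norm (p := 2) (by norm_num) (e.repr (T.toCLM (e i)))
        simpa [e.repr_apply_apply] using h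
    rw [summable_prod_of_nonneg fun _ => by positivity]
    refine ⟨fun i => (hrow i).summable, ?_⟩
    simp_rw [fun i => (hrow i).tsum_eq]
    exact (HilbertSchmidt.norm_sq_eq T).summable
  have hmem : Memℓp (fun p : basisIndex (L2Rn n) × basisIndex (L2Rn n) =>
      inner ℂ (e p.2) (T.toCLM (e p.1))) 2 := memℓp_gen (by simpa using hs)
  refine ⟨(ambiguityBasis e).repr.symm ⟨_, hmem⟩, ?_⟩
  rw [isWeylTransform_iff]
  refine clm_ext_of_hilbertBasis e fun i k => ?_
  rw [inner_weylCLM, ← ambiguityBasis_apply e (i, k),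
    ← (ambiguityBasis e).repr_apply_apply, LinearIsometryEquiv.apply_symm_apply]

/-- The Weyl transform is isometric. -/
theorem IsWeylTransform.inner_eq {g g' : Lp ℂ 2 (volume : Measure (Vec n × Vec n))} {T T' : B2 n}
    (h : IsWeylTransform g T) (h' : IsWeylTransform g' T') : inner ℂ g g' = inner ℂ T T' := by
  set e := basis (L2Rn n)
  rw [isWeylTransform_iff] at h h'
  have h1 := (ambiguityBasis e).hasSum_inner_mul_inner g g'
  simp_rw [ambiguityBasis_apply, ← inner_weylCLM, ← h'] at h1
  have h2 : ∀ i k, inner ℂ g (ambiguity (e i) (e k)) = inner ℂ (T.toCLM (e i)) (e k) := fun i k => by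
    rw [← inner_conj_symm, ← inner_weylCLM, ← h, inner_conj_symm]
  simp_rw [h2] at h1
  -- Summing over `k` first is Parseval in `e`, which leaves `∑ᵢ ⟪T eᵢ, T' eᵢ⟫`.
  have h3 := h1.prod_fiberwise fun i =>
    e.hasSum_inner_mul_inner (T.toCLM (e i)) (T'.toCLM (e i))
  rw [HilbertSchmidt.inner_eq_tsum, h3.tsum_eq]

theorem inner_weylInv (S T : B2 n) : inner ℂ (weylInv S) (weylInv T) = inner ℂ S T := by
  have hS := exists_isWeylTransform S
  have hT := exists_isWeylTransform T
  rw [weylInv, weylInv, dif_pos hS, dif_pos hT]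
  exact hS.choose_spec.inner_eq hT.choose_spec

theorem enorm_weylInv (T : B2 n) : ‖weylInv T‖ₑ = ‖T‖ₑ := by
  rw [← ofReal_norm, ← ofReal_norm, @norm_eq_sqrt_re_inner ℂ, inner_weylInv,
    ← @norm_eq_sqrt_re_inner ℂ]

end Weyl

/-! ### Folding integrals onto one period. -/

section Periodization

variable {T : ℝ}

theorem preimage_add_Ioc (T : ℝ) (s : ℤ) :
    (fun x : ℝ => x + s * T) ⁻¹' Set.Ioc (s • T) ((s + 1) • T) = Set.Ioc 0 T := by
  ext x
  simp only [Set.mem_preimage, Set.mem_Ioc, zsmul_eq_mul]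
  push_cast
  constructor <;> rintro ⟨h1, h2⟩ <;> constructor <;> linarith

theorem lintegral_eq_lintegral_Ioc_tsum (hT : 0 < T) {f : ℝ → ℝ≥0∞} (hf : AEMeasurable f) :
    ∫⁻ x, f x = ∫⁻ x in Set.Ioc 0 T, ∑' s : ℤ, f (x + s * T) := by
  have hmp : ∀ s : ℤ, MeasurePreserving (fun x : ℝ => x + s * T) volume volume := fun s =>
    measurePreserving_add_right volume _
  have hm : ∀ s : ℤ, AEMeasurable (fun x => f (x + s * T)) (volume.restrict (Set.Ioc 0 T)) :=
    fun s => (hf.comp_quasiMeasurePreserving (hmp s).quasiMeasurePreserving).restrict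
  rw [lintegral_tsum hm, ← setLIntegral_univ,
    ← iUnion_Ioc_zsmul hT, lintegral_iUnion (fun _ => measurableSet_Ioc)
    (Set.pairwise_disjoint_Ioc_zsmul T)]
  refine tsum_congr fun s => ?_
  rw [← preimage_add_Ioc T s]
  exact ((hmp s).setLIntegral_comp_preimage_emb (measurableEmbedding_addRight _) f _).symm

theorem integral_eq_integral_Ioc_tsum (hT : 0 < T) {f : ℝ → ℂ} (hf : Integrable f) :
    ∫ x, f x = ∫ x in Set.Ioc 0 T, ∑' s : ℤ, f (x + s * T) := by
  have hmp : ∀ s : ℤ, MeasurePreserving (fun x : ℝ => x + s * T) volume volume := fun s =>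
    measurePreserving_add_right volume _
  have hm : ∀ s : ℤ, AEStronglyMeasurable (fun x => f (x + s * T)) (volume.restrict (Set.Ioc 0 T)) :=
    fun s => (hf.aestronglyMeasurable.comp_measurePreserving (hmp s)).restrict
  rw [integral_tsum hm, ← setIntegral_univ, ← iUnion_Ioc_zsmul hT,
    integral_iUnion (fun _ => measurableSet_Ioc) (Set.pairwise_disjoint_Ioc_zsmul T) hf.integrableOn]
  · refine tsum_congr fun s => ?_
    rw [← preimage_add_Ioc T s]
    exact ((hmp s).setIntegral_preimage_emb (measurableEmbedding_addRight _) f _).symm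
  · rw [← lintegral_tsum fun s => (hm s).enorm,
      ← lintegral_eq_lintegral_Ioc_tsum hT hf.aestronglyMeasurable.enorm]
    exact hf.2.ne

/-- The Fourier coefficients over a period form an idempotent for convolution if and only if the
function takes only the values `0` and `1 / T`. -/
theorem hasSum_integral_expChar_iff (hT : 0 < T) {w : ℝ → ℝ} (hw : IntegrableOn w (Set.Ioc 0 T))
    {c : ℤ → ℂ} (hc : ∀ m : ℤ, c m = ∫ v in Set.Ioc 0 T, expChar (-(m / T)) v * (w v : ℂ)) :
    (∀ p q : ℤ, HasSum (fun k => c (k - p) * c (q - k)) (c (q - p))) ↔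
      ∀ᵐ v ∂volume.restrict (Set.Ioc 0 T), w v = 0 ∨ w v = 1 / T := by
  have : Fact (0 < T) := ⟨hT⟩
  -- The factor `T` compensates for the normalized Haar measure on the circle. It makes
  -- `fourierCoeff u` equal to `c` and turns `u² = u` into `w ∈ {0, 1/T}`.
  set f : ℝ → ℂ := fun v => ((T * w v : ℝ) : ℂ) with hf
  set u : AddCircle T → ℂ := AddCircle.liftIoc T 0 f with hu
  have hmk := AddCircle.measurePreserving_mk T 0
  rw [zero_add] at hmk
  have hucoe : ∀ v ∈ Set.Ioc 0 T, u (v : AddCircle T) = f v := fun v hv =>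
    AddCircle.liftIoc_coe_apply (by rwa [zero_add])
  have hcoef : ∀ m, fourierCoeff u m = c m := fun m => by
    -- `fourierCoeffOn` works on a circle of period `0 + T - 0`, equal to `T` only propositionally.
    have hexp : ∀ T' : ℝ, T' = T → ∀ v : ℝ,
        fourier (-m) (v : AddCircle T') = expChar (-(m / T)) v := fun T' hT' v => by
      rw [fourier_coe_apply, expChar, hT']
      congr 1
      push_cast
      ring
    rw [hu, fourierCoeff_liftIoc_eq, fourierCoeffOn_eq_integral, hc,
      intervalIntegral.integral_of_le (by linarith), ← integral_smul, zero_add]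
    refine setIntegral_congr_fun measurableSet_Ioc fun v _ => ?_
    have hT0 : (T : ℂ) ≠ 0 := by exact_mod_cast hT.ne'
    simp only [hf]
    rw [hexp _ (by ring)]
    simp only [sub_zero, smul_eq_mul, Complex.real_smul]
    push_cast
    field_simp
  have hui : Integrable u AddCircle.haarAddCircle := by
    have h1 : MemLp f 1 (volume.restrict (Set.Ioc 0 (0 + T))) := by
      rw [zero_add]
      exact memLp_one_iff_integrable.2 (hw.const_mul T).ofReal
    exact memLp_one_iff_integrable.1 h1.memLp_liftIoc.haarAddCircle
  have hreal : ∀ x, (starRingEnd ℂ) (u x) = u x := fun x => by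
    simp only [hu, AddCircle.liftIoc, Function.comp_apply, Set.domRestrict_apply, hf,
      Complex.conj_ofReal]
  simp_rw [← hcoef]
  rw [hasSum_fourierCoeff_mul_self_iff hui hreal]
  have hae : (∀ᵐ x ∂AddCircle.haarAddCircle, u x * u x = u x) ↔
      ∀ᵐ x : AddCircle T, u x * u x = u x := by
    rw [AddCircle.volume_eq_smul_haarAddCircle, Measure.ae_ennreal_smul_measure_iff (by simpa using hT)]
  have hum : AEMeasurable u (volume : Measure (AddCircle T)) := by
    rw [AddCircle.volume_eq_smul_haarAddCircle]
    exact hui.aemeasurable.smul_measure _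
  have hnull : NullMeasurableSet {x : AddCircle T | u x * u x = u x} :=
    nullMeasurableSet_eq_fun (hum.mul hum) hum
  have hpre : (∀ᵐ x : AddCircle T, u x * u x = u x) ↔
      ∀ᵐ v : ℝ ∂volume.restrict (Set.Ioc 0 T), u v * u v = u v := by
    have h := hmk.measure_preimage hnull.compl
    rw [ae_iff, ae_iff]
    change volume ({x : AddCircle T | u x * u x = u x}ᶜ) = 0 ↔ _
    rw [← h]
    rfl
  rw [hae, hpre, ae_restrict_iff' measurableSet_Ioc, ae_restrict_iff' measurableSet_Ioc]
  refine Filter.eventually_congr (Filter.Eventually.of_forall fun v => forall_congr' fun hv => ?_)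
  rw [hucoe v hv, hf]
  simp only
  rw [← Complex.ofReal_mul, Complex.ofReal_inj, eq_div_iff hT.ne', mul_comm (w v) T]
  constructor
  · intro h
    by_cases h0 : w v = 0
    · exact Or.inl h0
    · exact Or.inr (mul_right_cancel₀ (mul_ne_zero hT.ne' h0) (h.trans (one_mul _).symm))
  · rintro (h | h) <;> simp [h]

end Periodization

/-! ### Gram entries of the Gabor system. -/

section Gabor

variable {n : ℕ} {a b : ℝ} {G : L2B2 n}

/-- `v ↦ ∑ⱼ ‖F̂(e^v, j)‖²`. -/
noncomputable def fourierDensity (F : L2B2 n) (v : ℝ) : ℝ := ∑ j, ‖fourierT F (Real.exp v) j‖ ^ 2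

theorem fourierDensity_nonneg (F : L2B2 n) (v : ℝ) : 0 ≤ fourierDensity F v :=
  Finset.sum_nonneg fun _ _ => by positivity

theorem sum_inner_fourierT_self (F : L2B2 n) (v : ℝ) :
    ∑ j, inner ℂ (fourierT F (Real.exp v) j) (fourierT F (Real.exp v) j) =
      (fourierDensity F v : ℂ) := by
  simp only [fourierDensity, inner_self_eq_norm_sq_to_K]
  push_cast
  rfl

theorem integrable_fourierDensity (F : L2B2 n) : Integrable (fourierDensity F) := by
  have h := (integrable_sum_inner_fourierT F F).re
  simp_rw [sum_inner_fourierT_self] at h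
  exact h

/-- The Weyl isometry replaces symbols by Fourier transforms, and `ν e^{s/b}` becomes `v + s/b`: the
weight is the `1/b`-periodization of `fourierDensity`. -/
theorem gaborWeight_exp (q : GaborIndex n) (v : ℝ) : gaborWeight a b G q (Real.exp v) =
    ∑' s : ℤ, ENNReal.ofReal (fourierDensity (modulated a G q) (v + s * (1 / b))) := by
  have h : ∀ j : ℤˣ, ∀ s : ℤ, ‖gaborSymbol a G q (Real.exp v * Real.exp (s / b)) j‖ₑ ^ 2 =
      ENNReal.ofReal (‖fourierT (modulated a G q) (Real.exp (v + s * (1 / b))) j‖ ^ 2) := fun j s => by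
    rw [gaborSymbol, enorm_weylInv, ← Real.exp_add, mul_one_div, ← ofReal_norm,
      ENNReal.ofReal_pow (norm_nonneg _)]
  simp only [gaborWeight, h, sum_units, fourierDensity]
  rw [← ENNReal.tsum_add]
  exact tsum_congr fun s => (ENNReal.ofReal_add (by positivity) (by positivity)).symm

theorem lintegral_gaborWeight_ne_top (hb : 0 < b) (q : GaborIndex n) :
    ∫⁻ v in Set.Ioc 0 (1 / b), gaborWeight a b G q (Real.exp v) ≠ ∞ := by
  simp_rw [gaborWeight_exp]
  have hi := integrable_fourierDensity (modulated a G q)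
  rw [← lintegral_eq_lintegral_Ioc_tsum (one_div_pos.2 hb) hi.aemeasurable.ennreal_ofReal]
  exact hi.lintegral_lt_top.ne

theorem aemeasurable_gaborWeight_exp (q : GaborIndex n) :
    AEMeasurable fun v => gaborWeight a b G q (Real.exp v) := by
  simp_rw [gaborWeight_exp]
  exact AEMeasurable.tsum fun s =>
    ((integrable_fourierDensity (modulated a G q)).aemeasurable.comp_quasiMeasurePreserving
      (measurePreserving_add_right volume _).quasiMeasurePreserving).ennreal_ofReal

theorem expChar_add_period (hb : 0 < b) (k s : ℤ) (v : ℝ) :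
    expChar (b * k) (v + s * (1 / b)) = expChar (b * k) v := by
  have : ((2 * Real.pi * (b * k) * (v + s * (1 / b)) : ℝ) : ℂ) * Complex.I =
      ((2 * Real.pi * (b * k) * v : ℝ) : ℂ) * Complex.I +
        ((k * s : ℤ) : ℂ) * (2 * Real.pi * Complex.I) := by
    have hb' : (b : ℂ) ≠ 0 := by exact_mod_cast hb.ne'
    push_cast
    field_simp
  rw [expChar, this, Complex.exp_add, Complex.exp_int_mul_two_pi_mul_I, mul_one, expChar]

theorem inner_gabor (q q' : GaborIndex n) (p p' : ℤ) :
    inner ℂ (gabor a b G q p) (gabor a b G q' p') = ∫ v, expChar (b * (p - p' : ℤ)) v *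
      ∑ j, inner ℂ (fourierT (modulated a G q) (Real.exp v) j)
        (fourierT (modulated a G q') (Real.exp v) j) := by
  rw [gabor, gabor, inner_translation]
  push_cast
  rw [mul_sub]

/-- The frequency `b(p - p')` has period `1/b`, so the character factors out of the sum over shifts.
The entry depends only on `p' - p`. -/
theorem inner_gabor_self (hb : 0 < b) (q : GaborIndex n) (p p' : ℤ) :
    inner ℂ (gabor a b G q p) (gabor a b G q p') = ∫ v in Set.Ioc 0 (1 / b),
      expChar (-((p' - p : ℤ) / (1 / b))) v * ((gaborWeight a b G q (Real.exp v)).toReal : ℂ) := by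
  have hi := integrable_fourierDensity (modulated a G q)
  simp_rw [inner_gabor, sum_inner_fourierT_self]
  rw [integral_eq_integral_Ioc_tsum (one_div_pos.2 hb)]
  · refine integral_congr_ae (Filter.Eventually.of_forall fun v => ?_)
    have e : -(((p' - p : ℤ) : ℝ) / (1 / b)) = b * (p - p' : ℤ) := by push_cast; field_simp; ring
    simp only [expChar_add_period hb, e]
    rw [tsum_mul_left, gaborWeight_exp, ENNReal.tsum_toReal_eq fun _ => ENNReal.ofReal_ne_top,
      Complex.ofReal_tsum]
    simp_rw [ENNReal.toReal_ofReal (fourierDensity_nonneg _ _)]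
  · exact hi.ofReal.bdd_mul (c := 1) (continuous_expChar _).aestronglyMeasurable
      (Filter.Eventually.of_forall fun v => (norm_expChar _ v).le)

/-- The translates of the open period miss only the countable set of multiples of `1/b`. -/
theorem ae_exists_sub_mem_Ioo (hb : 0 < b) :
    ∀ᵐ v : ℝ, ∃ s : ℤ, v - s / b ∈ Set.Ioo 0 (1 / b) := by
  have hc : (Set.range fun s : ℤ => (s : ℝ) / b).Countable := Set.countable_range _
  filter_upwards [hc.ae_notMem volume] with v hv
  refine ⟨⌊v * b⌋, ?_, ?_⟩
  · rw [sub_pos]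
    refine lt_of_le_of_ne ?_ fun h => hv ⟨_, h⟩
    rw [div_le_iff₀ hb]
    exact Int.floor_le _
  · rw [sub_lt_iff_lt_add, ← add_div, lt_div_iff₀ hb, add_comm]
    exact Int.lt_floor_add_one _

theorem exp_mem_Ioo_iff (v : ℝ) : Real.exp v ∈ Set.Ioo 1 (Real.exp (1 / b)) ↔ v ∈ Set.Ioo 0 (1 / b) := by
  rw [Set.mem_Ioo, Set.mem_Ioo, Real.exp_lt_exp, Real.one_lt_exp_iff]

theorem inner_gabor_eq_zero (hb : 0 < b) {q q' : GaborIndex n}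
    (h : ∀ j : ℤˣ, ∀ s : ℤ, ∀ᵐ nu : ℝ, nu ∈ Set.Ioo 1 (Real.exp (1 / b)) →
      inner ℂ (gaborSymbol a G q (nu * Real.exp (s / b)) j)
        (gaborSymbol a G q' (nu * Real.exp (s / b)) j) = 0) (p p' : ℤ) :
    inner ℂ (gabor a b G q p) (gabor a b G q' p') = 0 := by
  -- Orthogonality on one period at every shift `s` is spread over the line, so that the Gram
  -- integrand itself vanishes a.e.
  have hz : ∀ᵐ v : ℝ, ∀ s : ℤ, ∀ j : ℤˣ, v - s / b ∈ Set.Ioo 0 (1 / b) →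
      inner ℂ (fourierT (modulated a G q) (Real.exp v) j)
        (fourierT (modulated a G q') (Real.exp v) j) = 0 := by
    rw [ae_all_iff]
    intro s
    rw [ae_all_iff]
    intro j
    have h1 := ae_comp_exp ((h j s).mono fun _ hx _ => hx)
    have h2 := (measurePreserving_sub_right (volume : Measure ℝ) (s / b)).quasiMeasurePreserving.ae h1
    filter_upwards [h2] with v hv hmem
    have := hv ((exp_mem_Ioo_iff _).2 hmem)
    rwa [gaborSymbol, gaborSymbol, inner_weylInv, ← Real.exp_add, sub_add_cancel] at this
  rw [inner_gabor, ← integral_zero ℝ ℂ (μ := volume)]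
  refine integral_congr_ae ?_
  filter_upwards [hz, ae_exists_sub_mem_Ioo hb] with v hv hs
  obtain ⟨s, hs⟩ := hs
  rw [Finset.sum_eq_zero fun j _ => hv s j hs, mul_zero]

theorem ae_gaborWeight_iff (hb : 0 < b) (q : GaborIndex n) :
    (∀ᵐ v ∂volume.restrict (Set.Ioc 0 (1 / b)), (gaborWeight a b G q (Real.exp v)).toReal = 0 ∨
      (gaborWeight a b G q (Real.exp v)).toReal = 1 / (1 / b)) ↔
    ∀ᵐ nu : ℝ, nu ∈ gaborSupport a b G q → gaborWeight a b G q nu = ENNReal.ofReal b := by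
  -- Finiteness a.e. is essential: `toReal` sends `∞` to `0`, so an infinite weight would be
  -- mistaken for a zero one.
  have hfin := ae_lt_top' (aemeasurable_gaborWeight_exp (a := a) (b := b) (G := G) q).restrict
    (lintegral_gaborWeight_ne_top hb q)
  rw [one_div_one_div]
  rw [← restrict_Ioo_eq_restrict_Ioc] at hfin ⊢
  have key : (∀ᵐ nu : ℝ, nu ∈ gaborSupport a b G q → gaborWeight a b G q nu = ENNReal.ofReal b) ↔
      ∀ᵐ v : ℝ, Real.exp v ∈ gaborSupport a b G q →
        gaborWeight a b G q (Real.exp v) = ENNReal.ofReal b := by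
    refine ⟨fun h => ae_comp_exp (h.mono fun _ hx _ => hx), fun h => ?_⟩
    filter_upwards [ae_of_comp_exp (P := fun nu => nu ∈ gaborSupport a b G q →
      gaborWeight a b G q nu = ENNReal.ofReal b) h] with nu hnu hmem
    exact hnu (zero_lt_one.trans hmem.1.1) hmem
  rw [ae_restrict_iff' measurableSet_Ioo] at hfin
  rw [key, ae_restrict_iff' measurableSet_Ioo]
  refine Filter.eventually_congr ?_
  filter_upwards [hfin] with v hv
  rw [gaborSupport, Set.mem_ofPred_eq, exp_mem_Ioo_iff, and_imp]
  refine forall_congr' fun hmem => ?_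
  have hlt := hv hmem
  rw [ENNReal.toReal_eq_zero_iff, or_iff_left hlt.ne, or_iff_not_imp_left]
  refine forall_congr' fun _ => ?_
  rw [← ENNReal.toReal_eq_toReal_iff' hlt.ne ENNReal.ofReal_ne_top, ENNReal.toReal_ofReal hb.le]

theorem hasSum_inner_gabor_iff (hb : 0 < b) (q : GaborIndex n) :
    (∀ p p' : ℤ, HasSum (fun k => inner ℂ (gabor a b G q p) (gabor a b G q k) *
      inner ℂ (gabor a b G q k) (gabor a b G q p')) (inner ℂ (gabor a b G q p) (gabor a b G q p'))) ↔
    ∀ᵐ nu : ℝ, nu ∈ gaborSupport a b G q → gaborWeight a b G q nu = ENNReal.ofReal b := by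
  have hw : IntegrableOn (fun v => (gaborWeight a b G q (Real.exp v)).toReal) (Set.Ioc 0 (1 / b)) :=
    integrable_toReal_of_lintegral_ne_top (aemeasurable_gaborWeight_exp q).restrict
      (lintegral_gaborWeight_ne_top hb q)
  rw [← ae_gaborWeight_iff hb, ← hasSum_integral_expChar_iff (one_div_pos.2 hb) hw fun _ => rfl]
  simp_rw [inner_gabor_self hb]

/-- A block diagonal matrix is idempotent iff its blocks are: in every product sum only the indices
of a common block survive. -/
theorem hasSum_prod_mul_iff {ι κ : Type} {M : ι × κ → ι × κ → ℂ}
    (h0 : ∀ i i' k k', i ≠ i' → M (i, k) (i', k') = 0) :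
    (∀ x y, HasSum (fun z => M x z * M z y) (M x y)) ↔
      ∀ i k k', HasSum (fun l => M (i, k) (i, l) * M (i, l) (i, k')) (M (i, k) (i, k')) := by
  have key : ∀ i k k', HasSum (fun l => M (i, k) (i, l) * M (i, l) (i, k')) (M (i, k) (i, k')) ↔
      HasSum (fun z => M (i, k) z * M z (i, k')) (M (i, k) (i, k')) := fun i k k' => by
    rw [← (Prod.mk_right_injective i).hasSum_iff]
    · rfl
    · rintro ⟨i', l⟩ hz
      rw [h0 i i' k l fun h => hz ⟨l, by rw [h]⟩, zero_mul]
  refine ⟨fun h i k k' => (key i k k').2 (h _ _), ?_⟩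
  rintro h ⟨i, k⟩ ⟨i', k'⟩
  by_cases hi : i = i'
  · subst hi
    exact (key i k k').1 (h i k k')
  · rw [h0 i i' k k' hi]
    convert! hasSum_zero (α := ℂ) (β := ι × κ) with z
    by_cases hz : i = z.1
    · rw [h0 z.1 i' z.2 k' (hz ▸ hi), mul_zero]
    · rw [h0 i z.1 k z.2 hz, zero_mul]

end Gabor

end HeisenbergGabor

theorem mainTheorem4 (n : ℕ) (a b : ℝ) (ha : 0 < a) (hb : 0 < b) (G : L2B2 n)
    (S : Set (GaborIndex n))
    (horth : ∀ j : ℤˣ, ∀ s : ℤ, ∀ᵐ nu : ℝ, nu ∈ Set.Ioo 1 (Real.exp (1 / b)) →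
      ∀ q ∈ S, ∀ q' ∈ S, q ≠ q' →
        inner ℂ (gaborSymbol a G q (nu * Real.exp (s / b)) j)
          (gaborSymbol a G q' (nu * Real.exp (s / b)) j) = 0) :
    IsParsevalFrameSequence (fun r : S × ℤ => gabor a b G r.1 r.2) ↔
      ∀ q ∈ S, ∀ᵐ nu : ℝ, nu ∈ gaborSupport a b G q → gaborWeight a b G q nu = ENNReal.ofReal b := by
  rw [isParsevalFrameSequence_iff_gram, hasSum_prod_mul_iff
    (M := fun x y : S × ℤ => inner ℂ (gabor a b G x.1 x.2) (gabor a b G y.1 y.2)), Subtype.forall]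
  · exact forall₂_congr fun q _ => hasSum_inner_gabor_iff hb q
  · intro q q' p p' hne
    refine inner_gabor_eq_zero hb (fun j s => ?_) p p'
    filter_upwards [horth j s] with nu hnu hmem
    exact hnu hmem q q.2 q' q'.2 fun h => hne (Subtype.ext h)
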